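/- **Setting.** Let $B$ be a $d$-dimensional Brownian motion on a probability space $(\Omega,\mathcal F,\mathbb P)$, let $T>0$, and let $X$ be the strong solution on $[0,T]$ of $dX_t=b(X_t)\,dt+a(X_t)\,dB_t$, $X_0=x_0\in\mathbb R^d$, where $b:\mathbb R^d\to\mathbb R^d$ and $a:\mathbb R^d\to\mathbb R^{d\times d}$ are bounded and Lipschitz, $a(x)$ is invertible for every $x$, and $a^{-1}$ is bounded. For $t\in[0,T]$ and $x\in\mathbb R^d$, $\mathbb E[\,\cdot\,|X_t=x]$ denotes expectation for the diffusion started from $x$ at time $t$, and $\mathbb E=\mathbb E[\,\cdot\,|X_0=x_0]$. Let $\omega_I,\omega_N>0$ with $\omega_U:=1-\omega_I-\omega_N>0$; $\gamma_I,\gamma_N>0$; $\alpha_j:=\omega_j/\gamma_j$ for $j\in\{I,N\}$; $\tau_N\in\mathbb R$ with $\alpha_I+\alpha_N\tau_N\ne0$; $\mu_N\in\mathbb R^d$; and let $C_I,C_N$ be symmetric positive definite $d\times d$ matrices. Put $C_U:=C_I+\big(\tfrac{\alpha_N}{\alpha_I+\alpha_N\tau_N}\big)^2C_N$, $P_I:=C_I^{-1}$,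 $P_U:=C_U^{-1}$. Let $\Pi=\omega_I\pi^I_0+\omega_N\pi^N_0+\omega_U\pi^U_0\in\mathbb R^d$, and let $\Psi:\mathbb R^d\to\mathbb R^d$ be $C^1$ with $\Pi'\Psi(x)>0$ for all $x$, with Jacobian of full rank for Lebesgue-almost every $x$, and with $|\Psi(x)|,|\partial_{x_i}\Psi(x)|\le e^{K(1+|x|)}$ ($i=1,\dots,d$) for some $K>0$. Assume $(\pi^U_0)'\Psi(X_T)>0$ almost surely. Define $$\vartheta(x,h):=\Pi'\Psi(x)-\alpha_Nx'P_I\mu_N+\tfrac12(\alpha_I+\alpha_N)x'(P_I-P_U)x-x'\big((\alpha_I+\alpha_N\tau_N)P_I-(\alpha_I+\alpha_N)P_U\big)h .$$ **Pricing function.** Let $U$ be the CRRA utility on $(0,\infty)$ with relative risk aversion $\eta_U=\eta\in(0,1]$, and let $I=(U')^{-1}$, so that $I(y)=y^{-1/\eta}$. Let $z=z(x,h,\kappa)>0$ be the solution of $\omega_UI(z)-(\alpha_I+\alpha_N)\log z=\vartheta(x,h)+\kappa$, and let $\hat\kappa(h;\eta)$ be the solution $\kappa$ of the budget equation $$0=\frac{\mathbb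 E\big[\big((\pi^U_0)'\Psi(X_T)-I(z(X_T,h,\kappa))\big)z(X_T,h,\kappa)e^{-\frac12X_T'P_UX_T+X_T'P_Uh}\big]}{\mathbb E\big[z(X_T,h,\kappa)e^{-\frac12X_T'P_UX_T+X_T'P_Uh}\big]} .$$ With $\check Z(x,h)$ proportional to $z(x,h,\hat\kappa(h;\eta))e^{-\frac12x'P_Ux+x'P_Uh}$ and $d\mathbb Q^h/d\mathbb P=\check Z(X_T,h)/\mathbb E[\check Z(X_T,h)]$, the pricing function is $S(t,x,h;\eta)=\mathbb E^{\mathbb Q^h}[\Psi(X_T)|X_t=x]$. **Proposition.** For every $h\in\mathbb R^d$ and $\eta\in(0,1]$, the solutions $z$ and $\hat\kappa(h;\eta)$ exist and are unique and $S(t,x,h;\eta)$ is well defined. The equation $$\frac1{\omega_U}=\frac{\mathbb E\Big[(\pi_0^U)'\Psi(X_T)\,e^{\frac{(\vartheta(X_T,h)+\kappa)^-}{\alpha_I+\alpha_N}-\frac12X_T'P_UX_T+X_T'P_Uh}\Big]}{\mathbb E\Big[(\vartheta(X_T,h)+\kappa)^+e^{-\frac12X_T'P_UX_T+X_T'P_Uh}\Big]}$$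 has a unique solution $\kappa=\hat\kappa(h;0)\in\mathbb R$, and for all $t\in[0,T]$, $x\in\mathbb R^d$, $$\lim_{\eta\downarrow0}S(t,x,h;\eta)=S(t,x,h;0):=\frac{\mathbb E\Big[\Psi(X_T)\,e^{\frac{(\vartheta(X_T,h)+\hat\kappa(h;0))^-}{\alpha_I+\alpha_N}-\frac12X_T'P_UX_T+X_T'P_Uh}\,\Big|\,X_t=x\Big]}{\mathbb E\Big[e^{\frac{(\vartheta(X_T,h)+\hat\kappa(h;0))^-}{\alpha_I+\alpha_N}-\frac12X_T'P_UX_T+X_T'P_Uh}\,\Big|\,X_t=x\Big]},$$ where all these expectations are finite. In general this limit differs from the risk-neutral price $$S(t,x,h;rn):=\frac{\mathbb E\big[\Psi(X_T)e^{-\frac12X_T'P_UX_T+X_T'P_Uh}\,\big|\,X_t=x\big]}{\mathbb E\big[e^{-\frac12X_T'P_UX_T+X_T'P_Uh}\,\big|\,X_t=x\big]}:$$ already for $d=1$, for every $T>0$ and every one-dimensional Brownian motion, there are primitives satisfying all the assumptions above with $X_T$ Gaussian, and a signal realization $h$, such that $S(0,x_0,h;0)\neq S(0,x_0,h;rn)$.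 -/

import Mathlib

open MeasureTheory ProbabilityTheory Filter Topology
open scoped NNReal ENNReal Matrix

noncomputable section

/-! ### The factor process -/

/-- The state space `ℝ^d` with its Euclidean norm. -/
abbrev StateSpace (d : ℕ) : Type := EuclideanSpace ℝ (Fin d)

/-- `d`-dimensional Brownian motion (started at `0`): the coordinates are independent standard
real Brownian motions. -/
structure IsBrownianMotion {Ω : Type*} [MeasurableSpace Ω] {d : ℕ}
    (B : ℝ≥0 → Ω → StateSpace d) (P : Measure Ω) : Prop where
  measurable : ∀ t, Measurable (B t)
  coord : ∀ i, IsBrownianReal (fun t ω => B t ω i) P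
  indep : iIndepFun (fun (i : Fin d) (ω : Ω) (t : ℝ≥0) => B t ω i) P

/-- The `σ`-algebra generated by `B` up to time `t`. -/
abbrev pastSigma {Ω : Type*} {d : ℕ} (B : ℝ≥0 → Ω → StateSpace d) (t : ℝ≥0) :
    MeasurableSpace Ω :=
  ⨆ s ∈ Set.Iic t, MeasurableSpace.comap (B s) inferInstance

/-- Conditions on the drift and volatility: `b` is bounded and Lipschitz; `a` is bounded, Lipschitz,
pointwise invertible, and `a⁻¹` is bounded (matrix bounds are written entrywise). -/
structure CoeffAssumption {d : ℕ} (b : StateSpace d → StateSpace d)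
    (a : StateSpace d → Matrix (Fin d) (Fin d) ℝ) : Prop where
  drift_bdd : ∃ K : ℝ, ∀ x, ‖b x‖ ≤ K
  drift_lip : ∃ K : ℝ, ∀ x y, ‖b x - b y‖ ≤ K * ‖x - y‖
  vol_bdd : ∃ K : ℝ, ∀ x i j, |a x i j| ≤ K
  vol_lip : ∃ K : ℝ, ∀ x y i j, |a x i j - a y i j| ≤ K * ‖x - y‖
  vol_invertible : ∀ x, IsUnit (a x).det
  vol_inv_bdd : ∃ K : ℝ, ∀ x i j, |(a x)⁻¹ i j| ≤ K

/-- The left-endpoint Riemann sum of `∫_{t₀}^{s} a(X_u) dB_u` on the uniform partition of `[t₀, s]`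
into `n` intervals. -/
def itoSum {Ω : Type*} {d : ℕ} (B : ℝ≥0 → Ω → StateSpace d)
    (a : StateSpace d → Matrix (Fin d) (Fin d) ℝ) (X : ℝ≥0 → Ω → StateSpace d)
    (t₀ s : ℝ≥0) (n : ℕ) (ω : Ω) : StateSpace d :=
  ∑ k ∈ Finset.range n,
    WithLp.toLp 2 (a (X (t₀ + k * ((s - t₀) / n)) ω) *ᵥ
      (B (t₀ + (k + 1) * ((s - t₀) / n)) ω - B (t₀ + k * ((s - t₀) / n)) ω).ofLp)

/-- `X` is a strong solution on `[t₀, T]` of `dX = b(X) dt + a(X) dB`, `X_{t₀} = x`: it is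
continuous, adapted to the `P`-augmentation of the filtration of `B`, and satisfies
`X_s - x - ∫_{t₀}^s b(X_u) du = ∫_{t₀}^s a(X_u) dB_u` for `s ∈ [t₀, T]`. The integrand `a(X)` of the
Itô integral is continuous and adapted, so that the integral is the limit in probability
of its left-endpoint Riemann sums. -/
structure IsStrongSolution {Ω : Type*} [MeasurableSpace Ω] (P : Measure Ω) {d : ℕ}
    (B : ℝ≥0 → Ω → StateSpace d) (b : StateSpace d → StateSpace d)
    (a : StateSpace d → Matrix (Fin d) (Fin d) ℝ)
    (T t₀ : ℝ≥0) (x : StateSpace d) (X : ℝ≥0 → Ω → StateSpace d) : Prop where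
  adapted : ∀ s ∈ Set.Icc t₀ T, ∃ g : Ω → StateSpace d,
    Measurable[pastSigma B s] g ∧ X s =ᵐ[P] g
  continuous : ∀ᵐ ω ∂P, ContinuousOn (fun s => X s ω) (Set.Icc t₀ T)
  initial : ∀ᵐ ω ∂P, X t₀ ω = x
  equation : ∀ s ∈ Set.Icc t₀ T,
    TendstoInMeasure P (fun n => itoSum B a X t₀ s n) atTop
      (fun ω => X s ω - x - ∫ u in (t₀ : ℝ)..(s : ℝ), b (X u.toNNReal ω))

/-! ### Primitives of the economy -/

/-- Primitives: weights, absolute risk aversions, parameters of the signals, supply, initial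
share endowments and payoff function. -/
structure Economy (d : ℕ) where
  /-- weight of the insider -/
  ωI : ℝ
  /-- weight of the noise trader -/
  ωN : ℝ
  /-- absolute risk aversion of the insider -/
  γI : ℝ
  /-- absolute risk aversion of the noise trader -/
  γN : ℝ
  /-- loading of the noise trader's signal on the insider's signal -/
  τN : ℝ
  /-- mean shift of the noise trader's signal -/
  μN : StateSpace d
  /-- covariance of the insider's signal noise -/
  CI : Matrix (Fin d) (Fin d) ℝ
  /-- covariance of the noise trader's signal noise -/
  CN : Matrix (Fin d) (Fin d) ℝ
  /-- outstanding supply of the risky assets -/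
  supply : StateSpace d
  /-- initial share endowment of the insider -/
  endowI : StateSpace d
  /-- initial share endowment of the noise trader -/
  endowN : StateSpace d
  /-- initial share endowment of the uninformed agent -/
  endowU : StateSpace d
  /-- payoff function -/
  Ψ : StateSpace d → StateSpace d

namespace Economy

variable {d : ℕ} (E : Economy d)

/-- Weight of the uninformed agent. -/
def ωU : ℝ := 1 - E.ωI - E.ωN

/-- Weighted risk tolerance of the insider. -/
def αI : ℝ := E.ωI / E.γI

/-- Weighted risk tolerance of the noise trader. -/
def αN : ℝ := E.ωN / E.γN

/-- Covariance of the noise in the market signal. -/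
def CU : Matrix (Fin d) (Fin d) ℝ :=
  E.CI + (E.αN / (E.αI + E.αN * E.τN)) ^ 2 • E.CN

/-- Precision of the insider's signal. -/
def PI : Matrix (Fin d) (Fin d) ℝ := E.CI⁻¹

/-- Precision of the market signal. -/
def PU : Matrix (Fin d) (Fin d) ℝ := E.CU⁻¹

/-- Conditions on the payoff function. -/
structure PayoffAssumption : Prop where
  contDiff : ContDiff ℝ 1 E.Ψ
  supply_pos : ∀ x, 0 < inner ℝ E.supply (E.Ψ x)
  jacobian : ∀ᵐ x ∂(volume : Measure (StateSpace d)), (fderiv ℝ E.Ψ x).det ≠ 0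
  growth : ∃ K : ℝ, 0 < K ∧ ∀ x, ‖E.Ψ x‖ ≤ Real.exp (K * (1 + ‖x‖)) ∧
    ∀ i, ‖fderiv ℝ E.Ψ x (EuclideanSpace.single i 1)‖ ≤ Real.exp (K * (1 + ‖x‖))

/-- Standing conditions on the agents, their signals and endowments. The condition
`αI + αN * τN ≠ 0` is what makes the market signal
`(αI G_I + αN (G_N - μN)) / (αI + αN τN)` well defined. -/
structure AgentAssumption : Prop where
  ωI_pos : 0 < E.ωI
  ωN_pos : 0 < E.ωN
  ωU_pos : 0 < E.ωU
  γI_pos : 0 < E.γI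
  γN_pos : 0 < E.γN
  CI_posDef : E.CI.PosDef
  CN_posDef : E.CN.PosDef
  signal : E.αI + E.αN * E.τN ≠ 0
  clearing : E.supply = E.ωI • E.endowI + E.ωN • E.endowN + E.ωU • E.endowU

/-- The function `ϑ(x, h)`. -/
def vartheta (x h : StateSpace d) : ℝ :=
  inner ℝ E.supply (E.Ψ x) - E.αN * (x.ofLp ⬝ᵥ (E.PI *ᵥ E.μN.ofLp))
    + 1 / 2 * (E.αI + E.αN) * (x.ofLp ⬝ᵥ ((E.PI - E.PU) *ᵥ x.ofLp))
    - x.ofLp ⬝ᵥ (((E.αI + E.αN * E.τN) • E.PI - (E.αI + E.αN) • E.PU) *ᵥ h.ofLp)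

/-- The weight `exp(-½ x' P_U x + x' P_U h)`. -/
def signalWeight (x h : StateSpace d) : ℝ :=
  Real.exp (-(1 / 2) * (x.ofLp ⬝ᵥ (E.PU *ᵥ x.ofLp)) + x.ofLp ⬝ᵥ (E.PU *ᵥ h.ofLp))

end Economy

/-! ### Utility of the uninformed agent -/

/-- Power (CRRA) utility with relative risk aversion `η`. -/
def crraUtility (η w : ℝ) : ℝ := if η = 1 then Real.log w else w ^ (1 - η) / (1 - η)

/-- Inverse `I` of the marginal utility of `U : (0,∞) → ℝ`. -/
def inverseMarginal (U : ℝ → ℝ) (y : ℝ) : ℝ := Function.invFunOn (deriv U) (Set.Ioi 0) y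

namespace Economy

variable {d : ℕ} (E : Economy d)

/-! ### The equilibrium pricing function -/

/-- `z` solves the clearing equation at `(x, h, κ)`. -/
def SolvesClearing (U : ℝ → ℝ) (x h : StateSpace d) (κ z : ℝ) : Prop :=
  0 < z ∧ E.ωU * inverseMarginal U z - (E.αI + E.αN) * Real.log z = E.vartheta x h + κ

/-- The solution `z(x, h, κ)` of the clearing equation. -/
def clearingZ (U : ℝ → ℝ) (x h : StateSpace d) (κ : ℝ) : ℝ :=
  Classical.epsilon (E.SolvesClearing U x h κ)

variable {Ω : Type*} [MeasurableSpace Ω]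

/-- `κ` enforces the budget constraint of the uninformed agent for the signal realization `h`;
`XT` is the terminal value of the factor process (all expectations are required to be finite). -/
def SolvesBudget (P : Measure Ω) (XT : Ω → StateSpace d) (U : ℝ → ℝ) (h : StateSpace d)
    (κ : ℝ) : Prop :=
  Integrable (fun ω => (inner ℝ E.endowU (E.Ψ (XT ω))
      - inverseMarginal U (E.clearingZ U (XT ω) h κ)) *
      (E.clearingZ U (XT ω) h κ * E.signalWeight (XT ω) h)) P ∧
  Integrable (fun ω => E.clearingZ U (XT ω) h κ * E.signalWeight (XT ω) h) P ∧
  0 = (∫ ω, (inner ℝ E.endowU (E.Ψ (XT ω))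
      - inverseMarginal U (E.clearingZ U (XT ω) h κ)) *
      (E.clearingZ U (XT ω) h κ * E.signalWeight (XT ω) h) ∂P) /
    ∫ ω, E.clearingZ U (XT ω) h κ * E.signalWeight (XT ω) h ∂P

/-- The constant `κ̂(h)` enforcing the budget constraint. -/
def kappaHat (P : Measure Ω) (XT : Ω → StateSpace d) (U : ℝ → ℝ) (h : StateSpace d) : ℝ :=
  Classical.epsilon (E.SolvesBudget P XT U h)

/-- The function `Ž(x, h)`, normalized by the law of the terminal value `XT`. -/
def checkZ (P : Measure Ω) (XT : Ω → StateSpace d) (U : ℝ → ℝ) (x h : StateSpace d) : ℝ :=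
  E.clearingZ U x h (E.kappaHat P XT U h) * E.signalWeight x h /
    ∫ ω, E.clearingZ U (XT ω) h (E.kappaHat P XT U h) * E.signalWeight (XT ω) h ∂P

/-- The pricing measure for the signal realization `h`: the probability with density proportional
to `Ž(YT, h)`. With `YT = XT` this is `ℚ^h`. With `YT` the terminal value of the diffusion started
from `x` at time `t` it is `ℚ^h` conditioned on `X_t = x`. -/
def pricingMeasure (P : Measure Ω) (XT : Ω → StateSpace d) (U : ℝ → ℝ) (h : StateSpace d)
    (YT : Ω → StateSpace d) : Measure Ω :=
  P.withDensity (fun ω =>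
    ENNReal.ofReal (E.checkZ P XT U (YT ω) h / ∫ ω', E.checkZ P XT U (YT ω') h ∂P))

/-- The pricing function `S(t, x, h) = 𝔼^{ℚ^h}[Ψ(X_T) | X_t = x]`, where `YT` is the terminal value
of the diffusion started from `x` at time `t`. -/
def price (P : Measure Ω) (XT : Ω → StateSpace d) (U : ℝ → ℝ) (h : StateSpace d)
    (YT : Ω → StateSpace d) : StateSpace d :=
  ∫ ω, E.Ψ (YT ω) ∂(E.pricingMeasure P XT U h YT)

/-! ### The limiting price -/

/-- The limiting weight `exp((ϑ(x,h)+κ)⁻/(α_I+α_N) - ½ x' P_U x + x' P_U h)`. -/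
def limitWeight (h : StateSpace d) (κ : ℝ) (x : StateSpace d) : ℝ :=
  Real.exp (max (-(E.vartheta x h + κ)) 0 / (E.αI + E.αN)
    - 1 / 2 * (x.ofLp ⬝ᵥ (E.PU *ᵥ x.ofLp)) + x.ofLp ⬝ᵥ (E.PU *ᵥ h.ofLp))

/-- The scalar equation for `κ = κ̂(h; 0)` (both expectations are required to be finite). -/
def SolvesLimit (P : Measure Ω) (XT : Ω → StateSpace d) (h : StateSpace d) (κ : ℝ) : Prop :=
  Integrable (fun ω => inner ℝ E.endowU (E.Ψ (XT ω)) * E.limitWeight h κ (XT ω)) P ∧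
  Integrable (fun ω => max (E.vartheta (XT ω) h + κ) 0 * E.signalWeight (XT ω) h) P ∧
  1 / E.ωU =
    (∫ ω, inner ℝ E.endowU (E.Ψ (XT ω)) * E.limitWeight h κ (XT ω) ∂P) /
      ∫ ω, max (E.vartheta (XT ω) h + κ) 0 * E.signalWeight (XT ω) h ∂P

/-- The constant `κ̂(h; 0)`. -/
def kappaHatZero (P : Measure Ω) (XT : Ω → StateSpace d) (h : StateSpace d) : ℝ :=
  Classical.epsilon (E.SolvesLimit P XT h)

/-- The limiting pricing function `S(t, x, h; 0)`, where `YT` is the terminal value of the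
diffusion started from `x` at time `t`. -/
def limitPrice (P : Measure Ω) (XT : Ω → StateSpace d) (h : StateSpace d)
    (YT : Ω → StateSpace d) : StateSpace d :=
  (∫ ω, E.limitWeight h (E.kappaHatZero P XT h) (YT ω) ∂P)⁻¹ •
    ∫ ω, E.limitWeight h (E.kappaHatZero P XT h) (YT ω) • E.Ψ (YT ω) ∂P

/-- The risk neutral pricing function `S(t, x, h; rn)`. -/
def riskNeutralPrice (P : Measure Ω) (h : StateSpace d) (YT : Ω → StateSpace d) :
    StateSpace d :=
  (∫ ω, E.signalWeight (YT ω) h ∂P)⁻¹ • ∫ ω, E.signalWeight (YT ω) h • E.Ψ (YT ω) ∂P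

/-- The standing assumptions: `B` is a Brownian motion, `X` is the diffusion with coefficients
`b`, `a` started from `x₀` at time `0`, the conditions on coefficients, payoff and agents
hold, and the endowment of the uninformed agent has positive terminal value. -/
structure Setting (P : Measure Ω) (T : ℝ≥0) (B : ℝ≥0 → Ω → StateSpace d)
    (b : StateSpace d → StateSpace d) (a : StateSpace d → Matrix (Fin d) (Fin d) ℝ)
    (x₀ : StateSpace d) (X : ℝ≥0 → Ω → StateSpace d) : Prop where
  brownian : IsBrownianMotion B P
  coeff : CoeffAssumption b a
  solution : IsStrongSolution P B b a T 0 x₀ X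
  payoff : E.PayoffAssumption
  agents : E.AgentAssumption
  endowU_pos : ∀ᵐ ω ∂P, 0 < inner ℝ E.endowU (E.Ψ (X T ω))

end Economy

end

/-! Write `w = log z`, `y = ϑ + κ`, `c = ω_U`, `A = α_I + α_N`. The clearing equation reads `c
e^{-w/η} - A w = y`. Its left side is a decreasing bijection in `w` with slope below `-A`, so `w` is
unique and `1/A`-Lipschitz in `y`, uniformly in `η`. As `η ↓ 0` the exponential vanishes for `w > 0`
and explodes for `w < 0`, which forces `w → y⁻/A`. Reading `e^{-w/η} = (y + A w)/c` off the equation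
gives `I(z) z → y⁺/c`. These two limits produce the weight and the scalar equation of the limiting
price (`tendsto_clearingLog_nhdsGT`, `tendsto_J_clearingLog`).

The budget equation seeks a zero in `κ` of `budgetGap`. `IsClearingProfile` records the monotonicity
and growth shared by all `η ∈ (0,1]` and by the limit, with one common constant. The gaps are
therefore continuous and antitone, and they converge pointwise by dominated convergence. Antitone
functions converging pointwise to one with a single root have convergent roots
(`IsBudgetData.tendsto_root`), so `κ̂(h;η) → κ̂(h;0)`. Dominated convergence in numerator and
denominator of the price then finishes the limit.

Integrability needs nothing about the law of `X_T` beyond measurability. Since `P_I ≥ P_U` and the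
aggregate payoff is positive, `ϑ⁻` grows at most linearly, and the Gaussian factor with precision
`P_U` absorbs `e^{ϑ⁻/A}` together with any exponential growth of the payoff: the integrands are
bounded functions of the state (`Economy.exists_exp_mul_weight_le`).

For the strict inequality take `X = W`, payoff `e^x` and `h = 0`. The endowment of the uninformed
agent is tuned to realize a chosen `κ`, for which `ϑ + κ` is negative only near a point `m` far to
the left. The limiting weight then exceeds the risk-neutral one only where the payoff lies below the
risk-neutral price, so the price falls. -/

/-! ### The scalar clearing equation -/

/-- The logarithm of the solution of the clearing equation `c z ^ (-1/η) - A log z = y`. -/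
noncomputable def clearingLog (c A η y : ℝ) : ℝ :=
  Classical.epsilon fun w => c * Real.exp (-w / η) - A * w = y

section ClearingLog

variable {c A η : ℝ}

theorem clearing_strictAnti (hc : 0 < c) (hA : 0 < A) (hη : 0 < η) :
    StrictAnti fun w : ℝ => c * Real.exp (-w / η) - A * w := by
  intro u v huv
  have h1 : Real.exp (-v / η) < Real.exp (-u / η) := by
    apply Real.exp_lt_exp.2
    gcongr
  have h2 : A * u < A * v := by gcongr
  have h3 : c * Real.exp (-v / η) < c * Real.exp (-u / η) := by gcongr
  simp only
  linarith

theorem clearing_surjective (hc : 0 < c) (hA : 0 < A) (hη : 0 < η) :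
    Function.Surjective fun w : ℝ => c * Real.exp (-w / η) - A * w := by
  have hcont : Continuous fun w : ℝ => -(c * Real.exp (-w / η) - A * w) := by fun_prop
  intro y
  have hbot : Tendsto (fun w : ℝ => -(c * Real.exp (-w / η) - A * w)) atBot atBot := by
    refine tendsto_atBot_mono (fun w => ?_) (tendsto_id.const_mul_atBot hA)
    have := Real.exp_pos (-w / η)
    simp only [id]
    nlinarith
  have htop : Tendsto (fun w : ℝ => -(c * Real.exp (-w / η) - A * w)) atTop atTop := by
    have h1 : Tendsto (fun w : ℝ => A * w + -c) atTop atTop :=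
      tendsto_atTop_add_const_right _ _ (tendsto_id.const_mul_atTop hA)
    refine tendsto_atTop_mono' _ ?_ h1
    filter_upwards [eventually_ge_atTop 0] with w hw
    have : Real.exp (-w / η) ≤ 1 := Real.exp_le_one_iff.2
      (div_nonpos_of_nonpos_of_nonneg (by linarith) hη.le)
    nlinarith
  obtain ⟨w, hw⟩ := hcont.surjective htop hbot (-y)
  exact ⟨w, neg_injective hw⟩

theorem clearingLog_spec (hc : 0 < c) (hA : 0 < A) (hη : 0 < η) (y : ℝ) :
    c * Real.exp (-clearingLog c A η y / η) - A * clearingLog c A η y = y :=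
  Classical.epsilon_spec (clearing_surjective hc hA hη y)

theorem clearingLog_eq (hc : 0 < c) (hA : 0 < A) (hη : 0 < η) (w : ℝ) :
    clearingLog c A η (c * Real.exp (-w / η) - A * w) = w :=
  (clearing_strictAnti hc hA hη).injective (clearingLog_spec hc hA hη _)

theorem clearingLog_strictAnti (hc : 0 < c) (hA : 0 < A) (hη : 0 < η) :
    StrictAnti (clearingLog c A η) := by
  intro y y' h
  by_contra! hle
  have := (clearing_strictAnti hc hA hη).antitone hle
  simp only [clearingLog_spec hc hA hη] at this
  linarith

/-- The exponential and the linear term of the clearing map move in the same direction, so the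
linear term alone controls the inverse. Uniformity in `η` is what later allows `κ` to vary with `η`.
-/
theorem abs_clearingLog_sub_le (hc : 0 < c) (hA : 0 < A) (hη : 0 < η) (y y' : ℝ) :
    |clearingLog c A η y - clearingLog c A η y'| ≤ |y - y'| / A := by
  wlog h : y ≤ y' generalizing y y'
  · rw [abs_sub_comm, abs_sub_comm y]
    exact this y' y (le_of_not_ge h)
  have hw := (clearingLog_strictAnti hc hA hη).antitone h
  have h1 := clearingLog_spec hc hA hη y
  have h2 := clearingLog_spec hc hA hη y'
  have h3 : Real.exp (-clearingLog c A η y / η) ≤ Real.exp (-clearingLog c A η y' / η) := by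
    apply Real.exp_le_exp.2
    gcongr
  rw [abs_of_nonneg (by linarith), abs_of_nonpos (by linarith), le_div_iff₀ hA]
  nlinarith

theorem continuous_clearingLog (hc : 0 < c) (hA : 0 < A) (hη : 0 < η) :
    Continuous (clearingLog c A η) := by
  refine (LipschitzWith.of_dist_le_mul (K := (1 / A).toNNReal) fun y y' => ?_).continuous
  rw [Real.dist_eq, Real.dist_eq, Real.coe_toNNReal _ (by positivity), one_div_mul_eq_div]
  exact abs_clearingLog_sub_le hc hA hη y y'

theorem neg_div_le_clearingLog (hc : 0 < c) (hA : 0 < A) (hη : 0 < η) (y : ℝ) :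
    -y / A ≤ clearingLog c A η y := by
  have h1 := clearingLog_spec hc hA hη y
  have := mul_pos hc (Real.exp_pos (-clearingLog c A η y / η))
  rw [div_le_iff₀ hA]
  linarith

theorem clearingLog_le (hc : 0 < c) (hA : 0 < A) (hη : 0 < η) (y : ℝ) :
    clearingLog c A η y ≤ c / A + max (-y) 0 / A := by
  have h1 := clearingLog_spec hc hA hη y
  have h2 := le_max_left (-y) 0
  have h3 := le_max_right (-y) 0
  rcases le_or_gt (clearingLog c A η y) 0 with hw | hw
  · exact hw.trans (by positivity)
  · have : Real.exp (-clearingLog c A η y / η) ≤ 1 := Real.exp_le_one_iff.2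
      (div_nonpos_of_nonpos_of_nonneg (by linarith) hη.le)
    rw [← add_div, le_div_iff₀ hA]
    nlinarith

/-- For `w ≤ 0` the equation gives `c e^{-w/η} = y + A w ≤ y`; for `w > 0` the exponential is at
most `1`. -/
theorem exp_neg_clearingLog_le (hc : 0 < c) (hA : 0 < A) (hη : 0 < η) (y : ℝ) :
    Real.exp (-clearingLog c A η y / η) ≤ 1 + max y 0 / c := by
  have h1 := clearingLog_spec hc hA hη y
  have h2 := le_max_left y 0
  have h3 := le_max_right y 0
  rcases le_or_gt (clearingLog c A η y) 0 with hw | hw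
  · have : Real.exp (-clearingLog c A η y / η) ≤ max y 0 / c := by
      rw [le_div_iff₀ hc]
      nlinarith
    linarith
  · have : Real.exp (-clearingLog c A η y / η) ≤ 1 := Real.exp_le_one_iff.2
      (div_nonpos_of_nonpos_of_nonneg (by linarith) hη.le)
    have : 0 ≤ max y 0 / c := by positivity
    linarith

theorem tendsto_clearingLog_atTop (hc : 0 < c) (hA : 0 < A) (hη : 0 < η) :
    Tendsto (clearingLog c A η) atTop atBot := by
  refine tendsto_atBot.2 fun M => ?_
  filter_upwards [eventually_ge_atTop (c * Real.exp (-M / η) - A * M)] with y hy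
  have := (clearingLog_strictAnti hc hA hη).antitone hy
  rwa [clearingLog_eq hc hA hη] at this

theorem tendsto_exp_neg_div_nhdsGT {δ : ℝ} (hδ : 0 < δ) :
    Tendsto (fun η : ℝ => Real.exp (-(δ / η))) (𝓝[>] 0) (𝓝 0) :=
  Real.tendsto_exp_neg_atTop_nhds_zero.comp (tendsto_inv_nhdsGT_zero.const_mul_atTop hδ)

/-- As `η ↓ 0`, the solution of the clearing equation converges to `exp (y⁻ / A)`. -/
theorem tendsto_clearingLog_nhdsGT (hc : 0 < c) (hA : 0 < A) (y : ℝ) :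
    Tendsto (fun η => clearingLog c A η y) (𝓝[>] 0) (𝓝 (max (-y) 0 / A)) := by
  have hpos : ∀ᶠ η : ℝ in 𝓝[>] 0, 0 < η := self_mem_nhdsWithin
  rw [Metric.tendsto_nhds]
  intro ε hε
  have hδ : 0 < ε / 2 := by positivity
  -- `e1` makes `c e^{-w/η} < A ε/2` whenever `w ≥ ε/2`; `e2` makes `c e^{-w/η} > |y| + 1` whenever
  -- `w ≤ -ε/2`, which contradicts `c e^{-w/η} = y + A w ≤ |y|`.
  have e1 : ∀ᶠ η : ℝ in 𝓝[>] 0, Real.exp (-((ε / 2) / η)) < ε / 2 * A / c :=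
    (tendsto_exp_neg_div_nhdsGT hδ).eventually_lt_const (by positivity)
  have e2 : ∀ᶠ η : ℝ in 𝓝[>] 0, Real.exp (-((ε / 2) / η)) < c / (|y| + 1) :=
    (tendsto_exp_neg_div_nhdsGT hδ).eventually_lt_const (by positivity)
  filter_upwards [hpos, e1, e2] with η hη h1 h2
  have hspec := clearingLog_spec hc hA hη y
  have hlow := neg_div_le_clearingLog hc hA hη y
  set w := clearingLog c A η y with hw
  have hm1 : -y / A ≤ max (-y) 0 / A := by gcongr; exact le_max_left _ _
  have hm2 : 0 ≤ max (-y) 0 / A := by positivity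
  have hmA : max (-y) 0 / A = max (-y / A) 0 := by
    rw [← max_div_div_right hA.le, zero_div]
  have hup : w < max (-y) 0 / A + ε := by
    rcases lt_or_ge w (ε / 2) with h | h
    · linarith
    · have : Real.exp (-w / η) ≤ Real.exp (-((ε / 2) / η)) := by
        apply Real.exp_le_exp.2
        rw [neg_div]
        gcongr
      have h3 : c * Real.exp (-w / η) < ε / 2 * A := by
        have := this.trans_lt h1
        rw [lt_div_iff₀ hc] at this
        linarith
      have : w < -y / A + ε / 2 := by
        rw [← sub_lt_iff_lt_add, lt_div_iff₀ hA]
        linarith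
      linarith
  have hlow' : -(ε / 2) < w := by
    by_contra! h
    have h3 : Real.exp (ε / 2 / η) ≤ Real.exp (-w / η) := by
      apply Real.exp_le_exp.2
      gcongr
      linarith
    rw [Real.exp_neg, inv_lt_comm₀ (Real.exp_pos _) (by positivity), inv_div] at h2
    have h4 : (|y| + 1) / c < Real.exp (-w / η) := h2.trans_le h3
    rw [div_lt_iff₀ hc] at h4
    have : A * w ≤ 0 := mul_nonpos_of_nonneg_of_nonpos hA.le (by linarith)
    have := le_abs_self y
    linarith
  rw [Real.dist_eq, abs_lt]
  constructor
  · rw [hmA]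
    rcases max_choice (-y / A) 0 with h | h <;> rw [h] <;> linarith
  · linarith

theorem tendsto_clearingLog_of_tendsto (hc : 0 < c) (hA : 0 < A) {k : ℝ → ℝ} {y : ℝ}
    (hk : Tendsto k (𝓝[>] 0) (𝓝 y)) :
    Tendsto (fun η => clearingLog c A η (k η)) (𝓝[>] 0) (𝓝 (max (-y) 0 / A)) := by
  have h0 : Tendsto (fun η => |k η - y| / A) (𝓝[>] 0) (𝓝 0) := by
    have : Tendsto (fun η => |k η - y| / A) (𝓝[>] 0) (𝓝 (|y - y| / A)) :=
      ((hk.sub_const y).abs).div_const A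
    simpa using this
  have h1 : Tendsto (fun η => clearingLog c A η (k η) - clearingLog c A η y) (𝓝[>] 0) (𝓝 0) := by
    refine squeeze_zero_norm' ?_ h0
    filter_upwards [self_mem_nhdsWithin] with η hη
    exact abs_clearingLog_sub_le hc hA hη _ _
  simpa using h1.add (tendsto_clearingLog_nhdsGT hc hA y)

end ClearingLog

/-! ### Budget equations for decreasing state prices -/

theorem integral_pos_of_ae_pos {Ω : Type*} [MeasurableSpace Ω] {P : Measure Ω} [NeZero P]
    {f : Ω → ℝ} (hf : Integrable f P) (hpos : ∀ᵐ ω ∂P, 0 < f ω) : 0 < ∫ ω, f ω ∂P := by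
  rw [integral_pos_iff_support_of_nonneg_ae (hpos.mono fun _ h => h.le) hf]
  rw [pos_iff_ne_zero]
  intro h0
  have h1 : ∀ᵐ ω ∂P, f ω = 0 := by
    rw [ae_iff]
    exact h0
  obtain ⟨ω, h2, h3⟩ := (hpos.and h1).exists
  exact h2.ne' h3

/-- The state price density `Z` and the value `J` of consumption, as functions of
`y = ϑ + κ`. -/
structure IsClearingProfile (A C : ℝ) (Z J : ℝ → ℝ) : Prop where
  Z_continuous : Continuous Z
  Z_antitone : Antitone Z
  le_Z : ∀ y, Real.exp (-y / A) ≤ Z y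
  Z_le : ∀ y, Z y ≤ C * Real.exp (max (-y) 0 / A)
  J_continuous : Continuous J
  J_monotone : Monotone J
  J_nonneg : ∀ y, 0 ≤ J y
  J_le : ∀ y, J y ≤ C * ((1 + |y|) * Real.exp (max (-y) 0 / A))

/-- Integrability of the random variables `θ = ϑ(X_T, h)`, `w` (the weight of the signal) and
`e` (the terminal endowment) that makes all expectations in the budget equations finite. -/
structure IsBudgetData {Ω : Type*} [MeasurableSpace Ω] (P : Measure Ω) (A : ℝ)
    (θ w e : Ω → ℝ) : Prop where
  A_pos : 0 < A
  aemeasurable_θ : AEMeasurable θ P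
  aemeasurable_w : AEMeasurable w P
  aemeasurable_e : AEMeasurable e P
  w_pos : ∀ ω, 0 < w ω
  e_pos : ∀ᵐ ω ∂P, 0 < e ω
  integrable : Integrable (fun ω => Real.exp (max (-θ ω) 0 / A) * w ω) P
  integrable_e : Integrable (fun ω => e ω * (Real.exp (max (-θ ω) 0 / A) * w ω)) P
  integrable_θ : Integrable (fun ω => |θ ω| * (Real.exp (max (-θ ω) 0 / A) * w ω)) P

/-- Value of the endowment minus value of consumption. -/
noncomputable def budgetGap {Ω : Type*} [MeasurableSpace Ω] (P : Measure Ω) (θ w e : Ω → ℝ)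
    (Z J : ℝ → ℝ) (κ : ℝ) : ℝ :=
  ∫ ω, e ω * (Z (θ ω + κ) * w ω) ∂P - ∫ ω, J (θ ω + κ) * w ω ∂P

/-- Shifting by a bounded `κ` costs only a constant factor, so one dominating function serves all
`κ` in a bounded set. -/
theorem exp_max_neg_add_le {A : ℝ} (hA : 0 < A) {R κ : ℝ} (hκ : |κ| ≤ R) (y : ℝ) :
    Real.exp (max (-(y + κ)) 0 / A) ≤ Real.exp (R / A) * Real.exp (max (-y) 0 / A) := by
  rw [← Real.exp_add, ← add_div]
  gcongr
  have := neg_abs_le κ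
  have := abs_nonneg κ
  have := le_max_left (-y) 0
  have := le_max_right (-y) 0
  apply max_le <;> linarith

namespace IsClearingProfile

variable {A C : ℝ} {Z J : ℝ → ℝ}

theorem Z_pos (hp : IsClearingProfile A C Z J) (y : ℝ) : 0 < Z y :=
  (Real.exp_pos _).trans_le (hp.le_Z y)

theorem C_pos (hp : IsClearingProfile A C Z J) : 0 < C := by
  have := (hp.Z_pos 0).trans_le (hp.Z_le 0)
  exact pos_of_mul_pos_left this (Real.exp_pos _).le

theorem Z_add_le (hp : IsClearingProfile A C Z J) (hA : 0 < A) {R κ : ℝ} (hκ : |κ| ≤ R) (y : ℝ) :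
    Z (y + κ) ≤ C * Real.exp (R / A) * Real.exp (max (-y) 0 / A) := by
  have := hp.C_pos
  calc Z (y + κ) ≤ C * Real.exp (max (-(y + κ)) 0 / A) := hp.Z_le _
    _ ≤ C * (Real.exp (R / A) * Real.exp (max (-y) 0 / A)) := by
      gcongr; exact exp_max_neg_add_le hA hκ y
    _ = _ := by ring

theorem J_add_le (hp : IsClearingProfile A C Z J) (hA : 0 < A) {R κ : ℝ} (hκ : |κ| ≤ R) (y : ℝ) :
    J (y + κ) ≤ C * Real.exp (R / A) * ((1 + R + |y|) * Real.exp (max (-y) 0 / A)) := by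
  have := hp.C_pos
  have hR : 0 ≤ R := (abs_nonneg κ).trans hκ
  calc J (y + κ) ≤ C * ((1 + |y + κ|) * Real.exp (max (-(y + κ)) 0 / A)) := hp.J_le _
    _ ≤ C * ((1 + R + |y|) * (Real.exp (R / A) * Real.exp (max (-y) 0 / A))) := by
      have h1 : 1 + |y + κ| ≤ 1 + R + |y| := by linarith [abs_add_le y κ]
      exact mul_le_mul_of_nonneg_left (mul_le_mul h1 (exp_max_neg_add_le hA hκ y)
        (Real.exp_pos _).le (by positivity)) this.le
    _ = _ := by ring

end IsClearingProfile

/-! ### Domination, monotonicity and roots of the budget gap. -/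

namespace IsBudgetData

variable {Ω : Type*} [MeasurableSpace Ω] {P : Measure Ω} {A C : ℝ} {θ w e : Ω → ℝ}
  {Z J : ℝ → ℝ}

theorem integrable_bound_J (hb : IsBudgetData P A θ w e) (C R : ℝ) :
    Integrable (fun ω => C * Real.exp (R / A) *
      ((1 + R + |θ ω|) * Real.exp (max (-θ ω) 0 / A)) * w ω) P := by
  have := ((hb.integrable.const_mul (1 + R)).add hb.integrable_θ).const_mul (C * Real.exp (R / A))
  refine this.congr (Eventually.of_forall fun ω => ?_)
  simp only [Pi.add_apply]
  ring

theorem integrable_bound_Z (hb : IsBudgetData P A θ w e) (C R : ℝ) :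
    Integrable (fun ω => C * Real.exp (R / A) * Real.exp (max (-θ ω) 0 / A) * w ω) P := by
  refine (hb.integrable.const_mul (C * Real.exp (R / A))).congr (Eventually.of_forall fun ω => ?_)
  simp only
  ring

theorem integrable_bound_eZ (hb : IsBudgetData P A θ w e) (C R : ℝ) :
    Integrable (fun ω => |e ω| * (C * Real.exp (R / A) * Real.exp (max (-θ ω) 0 / A) * w ω)) P := by
  refine (hb.integrable_e.abs.const_mul (C * Real.exp (R / A))).congr
    (Eventually.of_forall fun ω => ?_)
  have := hb.w_pos ω
  simp only [abs_mul, Real.abs_exp, abs_of_pos this]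
  ring

theorem norm_Z_le (hb : IsBudgetData P A θ w e) (hp : IsClearingProfile A C Z J) {R κ : ℝ}
    (hκ : |κ| ≤ R) (ω : Ω) :
    ‖Z (θ ω + κ) * w ω‖ ≤ C * Real.exp (R / A) * Real.exp (max (-θ ω) 0 / A) * w ω := by
  have := hb.w_pos ω
  have := hp.Z_pos (θ ω + κ)
  rw [Real.norm_of_nonneg (by positivity)]
  gcongr
  exact hp.Z_add_le hb.A_pos hκ _

theorem norm_eZ_le (hb : IsBudgetData P A θ w e) (hp : IsClearingProfile A C Z J) {R κ : ℝ}
    (hκ : |κ| ≤ R) (ω : Ω) :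
    ‖e ω * (Z (θ ω + κ) * w ω)‖ ≤
      |e ω| * (C * Real.exp (R / A) * Real.exp (max (-θ ω) 0 / A) * w ω) := by
  rw [norm_mul, Real.norm_eq_abs (e ω)]
  gcongr
  exact hb.norm_Z_le hp hκ ω

theorem norm_J_le (hb : IsBudgetData P A θ w e) (hp : IsClearingProfile A C Z J) {R κ : ℝ}
    (hκ : |κ| ≤ R) (ω : Ω) :
    ‖J (θ ω + κ) * w ω‖ ≤
      C * Real.exp (R / A) * ((1 + R + |θ ω|) * Real.exp (max (-θ ω) 0 / A)) * w ω := by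
  have := hb.w_pos ω
  have := hp.J_nonneg (θ ω + κ)
  rw [Real.norm_of_nonneg (by positivity)]
  gcongr
  exact hp.J_add_le hb.A_pos hκ _

theorem aestronglyMeasurable_Z (hb : IsBudgetData P A θ w e) (hp : IsClearingProfile A C Z J)
    (κ : ℝ) : AEStronglyMeasurable (fun ω => Z (θ ω + κ) * w ω) P :=
  ((hp.Z_continuous.measurable.comp_aemeasurable (hb.aemeasurable_θ.add_const κ)).mul
    hb.aemeasurable_w).aestronglyMeasurable

theorem aestronglyMeasurable_eZ (hb : IsBudgetData P A θ w e) (hp : IsClearingProfile A C Z J)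
    (κ : ℝ) : AEStronglyMeasurable (fun ω => e ω * (Z (θ ω + κ) * w ω)) P :=
  hb.aemeasurable_e.aestronglyMeasurable.mul (hb.aestronglyMeasurable_Z hp κ)

theorem aestronglyMeasurable_J (hb : IsBudgetData P A θ w e) (hp : IsClearingProfile A C Z J)
    (κ : ℝ) : AEStronglyMeasurable (fun ω => J (θ ω + κ) * w ω) P :=
  ((hp.J_continuous.measurable.comp_aemeasurable (hb.aemeasurable_θ.add_const κ)).mul
    hb.aemeasurable_w).aestronglyMeasurable

theorem integrable_Z (hb : IsBudgetData P A θ w e) (hp : IsClearingProfile A C Z J) (κ : ℝ) :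
    Integrable (fun ω => Z (θ ω + κ) * w ω) P :=
  (hb.integrable_bound_Z C |κ|).mono' (hb.aestronglyMeasurable_Z hp κ)
    (Eventually.of_forall (hb.norm_Z_le hp le_rfl))

theorem integrable_eZ (hb : IsBudgetData P A θ w e) (hp : IsClearingProfile A C Z J) (κ : ℝ) :
    Integrable (fun ω => e ω * (Z (θ ω + κ) * w ω)) P :=
  (hb.integrable_bound_eZ C |κ|).mono' (hb.aestronglyMeasurable_eZ hp κ)
    (Eventually.of_forall (hb.norm_eZ_le hp le_rfl))

theorem integrable_J (hb : IsBudgetData P A θ w e) (hp : IsClearingProfile A C Z J) (κ : ℝ) :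
    Integrable (fun ω => J (θ ω + κ) * w ω) P :=
  (hb.integrable_bound_J C |κ|).mono' (hb.aestronglyMeasurable_J hp κ)
    (Eventually.of_forall (hb.norm_J_le hp le_rfl))

theorem continuous_budgetGap (hb : IsBudgetData P A θ w e) (hp : IsClearingProfile A C Z J) :
    Continuous (budgetGap P θ w e Z J) := by
  rw [continuous_iff_continuousAt]
  intro κ₀
  have hR : ∀ᶠ κ in 𝓝 κ₀, |κ| ≤ |κ₀| + 1 :=
    (continuous_abs.tendsto κ₀).eventually_le_const (by linarith)
  refine ContinuousAt.sub ?_ ?_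
  · refine continuousAt_of_dominated (Eventually.of_forall (hb.aestronglyMeasurable_eZ hp))
      (hR.mono fun κ hκ => Eventually.of_forall (hb.norm_eZ_le hp hκ))
      (hb.integrable_bound_eZ C _) (Eventually.of_forall fun ω => ?_)
    have := hp.Z_continuous
    fun_prop
  · refine continuousAt_of_dominated (Eventually.of_forall (hb.aestronglyMeasurable_J hp))
      (hR.mono fun κ hκ => Eventually.of_forall (hb.norm_J_le hp hκ))
      (hb.integrable_bound_J C _) (Eventually.of_forall fun ω => ?_)
    have := hp.J_continuous
    fun_prop

theorem integral_eZ_antitone (hb : IsBudgetData P A θ w e) (hp : IsClearingProfile A C Z J) :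
    Antitone fun κ => ∫ ω, e ω * (Z (θ ω + κ) * w ω) ∂P := by
  intro κ κ' h
  refine integral_mono_ae (hb.integrable_eZ hp κ') (hb.integrable_eZ hp κ) ?_
  filter_upwards [hb.e_pos] with ω he
  have := hb.w_pos ω
  gcongr
  exact hp.Z_antitone (by linarith)

theorem integral_J_monotone (hb : IsBudgetData P A θ w e) (hp : IsClearingProfile A C Z J) :
    Monotone fun κ => ∫ ω, J (θ ω + κ) * w ω ∂P := by
  intro κ κ' h
  refine integral_mono (hb.integrable_J hp κ) (hb.integrable_J hp κ') fun ω => ?_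
  have := hb.w_pos ω
  simp only
  gcongr
  exact hp.J_monotone (by linarith)

theorem budgetGap_antitone (hb : IsBudgetData P A θ w e) (hp : IsClearingProfile A C Z J) :
    Antitone (budgetGap P θ w e Z J) := fun _ _ h =>
  sub_le_sub (hb.integral_eZ_antitone hp h) (hb.integral_J_monotone hp h)

theorem integral_Z_pos [NeZero P] (hb : IsBudgetData P A θ w e) (hp : IsClearingProfile A C Z J)
    (κ : ℝ) : 0 < ∫ ω, Z (θ ω + κ) * w ω ∂P :=
  integral_pos_of_ae_pos (hb.integrable_Z hp κ)
    (Eventually.of_forall fun ω => mul_pos (hp.Z_pos _) (hb.w_pos ω))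

theorem integral_eZ_pos [NeZero P] (hb : IsBudgetData P A θ w e) (hp : IsClearingProfile A C Z J)
    (κ : ℝ) : 0 < ∫ ω, e ω * (Z (θ ω + κ) * w ω) ∂P :=
  integral_pos_of_ae_pos (hb.integrable_eZ hp κ)
    (hb.e_pos.mono fun ω he => mul_pos he (mul_pos (hp.Z_pos _) (hb.w_pos ω)))

/-- As `κ → -∞`, the lower bound `Z y ≥ e^{-y/A}` makes the endowment value grow at least like
`e^{-κ/A}`, while the consumption value stays below its value at `κ = 0`. -/
theorem exists_budgetGap_pos [NeZero P] (hb : IsBudgetData P A θ w e)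
    (hp : IsClearingProfile A C Z J) : ∃ κ, 0 < budgetGap P θ w e Z J κ := by
  have hA := hb.A_pos
  have hint : Integrable (fun ω => e ω * (Real.exp (-θ ω / A) * w ω)) P := by
    refine hb.integrable_e.mono ?_ (Eventually.of_forall fun ω => ?_)
    · have := hb.aemeasurable_θ
      have := hb.aemeasurable_e
      have := hb.aemeasurable_w
      exact AEMeasurable.aestronglyMeasurable (by fun_prop)
    · have := hb.w_pos ω
      simp only [norm_mul, Real.norm_eq_abs, Real.abs_exp]
      gcongr
      exact le_max_left _ _
  set m := ∫ ω, e ω * (Real.exp (-θ ω / A) * w ω) ∂P with hm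
  have hm0 : 0 < m := integral_pos_of_ae_pos hint
    (hb.e_pos.mono fun ω he => mul_pos he (mul_pos (Real.exp_pos _) (hb.w_pos ω)))
  have hlow : ∀ κ, Real.exp (-κ / A) * m ≤ ∫ ω, e ω * (Z (θ ω + κ) * w ω) ∂P := by
    intro κ
    rw [hm, ← integral_const_mul]
    refine integral_mono_ae (hint.const_mul _) (hb.integrable_eZ hp κ) ?_
    filter_upwards [hb.e_pos] with ω he
    have := hb.w_pos ω
    calc Real.exp (-κ / A) * (e ω * (Real.exp (-θ ω / A) * w ω))
        = e ω * (Real.exp (-(θ ω + κ) / A) * w ω) := by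
          rw [neg_add, add_div, Real.exp_add]; ring
      _ ≤ _ := by gcongr; exact hp.le_Z _
  have hlim : Tendsto (fun κ : ℝ => Real.exp (-κ / A) * m) atBot atTop :=
    (Real.tendsto_exp_atTop.comp (tendsto_neg_atBot_atTop.atTop_div_const hA)).atTop_mul_const hm0
  obtain ⟨κ, h1, h2⟩ := ((hlim.eventually_gt_atTop (∫ ω, J (θ ω + 0) * w ω ∂P)).and
    (eventually_le_atBot 0)).exists
  refine ⟨κ, ?_⟩
  have h3 := hlow κ
  have h4 := hb.integral_J_monotone hp h2
  simp only [budgetGap] at *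
  linarith

theorem exists_budgetGap_eq_zero [NeZero P] (hb : IsBudgetData P A θ w e)
    (hp : IsClearingProfile A C Z J) (hneg : ∃ κ, budgetGap P θ w e Z J κ < 0) :
    ∃ κ, budgetGap P θ w e Z J κ = 0 := by
  obtain ⟨κ₁, h1⟩ := hb.exists_budgetGap_pos hp
  obtain ⟨κ₂, h2⟩ := hneg
  exact mem_range_of_exists_le_of_exists_ge (hb.continuous_budgetGap hp) ⟨κ₂, h2.le⟩ ⟨κ₁, h1.le⟩

/-- Strictness has to come from `Z`: for logarithmic utility `J` is constant. -/
theorem budgetGap_strictAnti [NeZero P] (hb : IsBudgetData P A θ w e)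
    (hp : IsClearingProfile A C Z J) (hZ : StrictAnti Z) :
    StrictAnti (budgetGap P θ w e Z J) := by
  intro κ κ' h
  have h1 : 0 < ∫ ω, (e ω * (Z (θ ω + κ) * w ω) - e ω * (Z (θ ω + κ') * w ω)) ∂P := by
    refine integral_pos_of_ae_pos ((hb.integrable_eZ hp κ).sub (hb.integrable_eZ hp κ')) ?_
    filter_upwards [hb.e_pos] with ω he
    have := hb.w_pos ω
    have : Z (θ ω + κ') < Z (θ ω + κ) := hZ (by linarith)
    rw [sub_pos]
    gcongr
  rw [integral_sub (hb.integrable_eZ hp κ) (hb.integrable_eZ hp κ')] at h1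
  have := hb.integral_J_monotone hp h.le
  simp only [budgetGap] at *
  linarith

/-- The endowment value tends to `0`, dominated by its integrand at `κ = 0`, while the consumption
value stays above a positive number. The limiting profile has neither property, since there `Z ≥ 1`
and `J` vanishes on the negative half-line; it is treated separately. -/
theorem exists_budgetGap_neg_of_tendsto_zero [NeZero P] (hb : IsBudgetData P A θ w e)
    (hp : IsClearingProfile A C Z J) (hZ : Tendsto Z atTop (𝓝 0)) (hJ : ∀ y, 0 < J y) :
    ∃ κ, budgetGap P θ w e Z J κ < 0 := by
  have hlim : Tendsto (fun κ => ∫ ω, e ω * (Z (θ ω + κ) * w ω) ∂P) atTop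
      (𝓝 (∫ _, (0 : ℝ) ∂P)) := by
    refine tendsto_integral_filter_of_dominated_convergence _
      (Eventually.of_forall (hb.aestronglyMeasurable_eZ hp)) ?_ (hb.integrable_bound_eZ C 0) ?_
    · filter_upwards [eventually_ge_atTop 0] with κ hκ
      refine Eventually.of_forall fun ω => ?_
      refine le_trans ?_ (hb.norm_eZ_le hp (κ := 0) abs_zero.le ω)
      have := hb.w_pos ω
      simp only [norm_mul, Real.norm_eq_abs, abs_of_pos (hp.Z_pos _)]
      gcongr
      exact hp.Z_antitone (by linarith)
    · refine Eventually.of_forall fun ω => ?_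
      have := ((hZ.comp (tendsto_atTop_add_const_left _ (θ ω) tendsto_id)).mul_const
        (w ω)).const_mul (e ω)
      simpa using this
  rw [integral_zero] at hlim
  have hJ0 : 0 < ∫ ω, J (θ ω + 0) * w ω ∂P := integral_pos_of_ae_pos (hb.integrable_J hp 0)
    (Eventually.of_forall fun ω => mul_pos (hJ _) (hb.w_pos ω))
  obtain ⟨κ, h1, h2⟩ := ((hlim.eventually_lt_const hJ0).and (eventually_ge_atTop 0)).exists
  refine ⟨κ, ?_⟩
  have := hb.integral_J_monotone hp h2
  simp only [budgetGap] at *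
  linarith

theorem tendsto_budgetGap {Zη Jη : ℝ → ℝ → ℝ} (hb : IsBudgetData P A θ w e)
    (hpη : ∀ᶠ η in 𝓝[>] 0, IsClearingProfile A C (Zη η) (Jη η))
    (hZ : ∀ y, Tendsto (fun η => Zη η y) (𝓝[>] 0) (𝓝 (Z y)))
    (hJ : ∀ y, Tendsto (fun η => Jη η y) (𝓝[>] 0) (𝓝 (J y))) (κ : ℝ) :
    Tendsto (fun η => budgetGap P θ w e (Zη η) (Jη η) κ) (𝓝[>] 0)
      (𝓝 (budgetGap P θ w e Z J κ)) := by
  refine Tendsto.sub ?_ ?_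
  · exact tendsto_integral_filter_of_dominated_convergence _
      (hpη.mono fun η h => hb.aestronglyMeasurable_eZ h κ)
      (hpη.mono fun η h => Eventually.of_forall (hb.norm_eZ_le h le_rfl))
      (hb.integrable_bound_eZ C |κ|)
      (Eventually.of_forall fun ω => ((hZ _).mul_const _).const_mul _)
  · exact tendsto_integral_filter_of_dominated_convergence _
      (hpη.mono fun η h => hb.aestronglyMeasurable_J h κ)
      (hpη.mono fun η h => Eventually.of_forall (hb.norm_J_le h le_rfl))
      (hb.integrable_bound_J C |κ|)
      (Eventually.of_forall fun ω => (hJ _).mul_const _)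

/-- Roots of the budget gaps converge to the unique root of the limiting budget gap. -/
theorem tendsto_root {Zη Jη : ℝ → ℝ → ℝ} (hb : IsBudgetData P A θ w e)
    (hp : IsClearingProfile A C Z J)
    (hpη : ∀ᶠ η in 𝓝[>] 0, IsClearingProfile A C (Zη η) (Jη η))
    (hZ : ∀ y, Tendsto (fun η => Zη η y) (𝓝[>] 0) (𝓝 (Z y)))
    (hJ : ∀ y, Tendsto (fun η => Jη η y) (𝓝[>] 0) (𝓝 (J y))) {κ : ℝ → ℝ} {κ₀ : ℝ}
    (hκ : ∀ᶠ η in 𝓝[>] 0, budgetGap P θ w e (Zη η) (Jη η) (κ η) = 0)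
    (hκ₀ : budgetGap P θ w e Z J κ₀ = 0)
    (huniq : ∀ k, budgetGap P θ w e Z J k = 0 → k = κ₀) :
    Tendsto κ (𝓝[>] 0) (𝓝 κ₀) := by
  -- Uniqueness gives the limiting gap a strict sign at each `k ≠ κ₀`. The sign persists for small
  -- `η`, and monotonicity then places the root on the correct side of `k`; no compactness is
  -- needed.
  refine tendsto_order.2 ⟨fun k hk => ?_, fun k hk => ?_⟩
  · have h1 : 0 < budgetGap P θ w e Z J k := by
      refine lt_of_le_of_ne ?_ fun h => hk.ne (huniq k h.symm)
      rw [← hκ₀]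
      exact hb.budgetGap_antitone hp hk.le
    filter_upwards [hpη, hκ, (hb.tendsto_budgetGap hpη hZ hJ k).eventually_const_lt h1]
      with η hη h2 h3
    by_contra! h4
    have := hb.budgetGap_antitone hη h4
    linarith
  · have h1 : budgetGap P θ w e Z J k < 0 := by
      refine lt_of_le_of_ne ?_ fun h => hk.ne' (huniq k h)
      rw [← hκ₀]
      exact hb.budgetGap_antitone hp hk.le
    filter_upwards [hpη, hκ, (hb.tendsto_budgetGap hpη hZ hJ k).eventually_lt_const h1]
      with η hη h2 h3
    by_contra! h4
    have := hb.budgetGap_antitone hη h4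
    linarith

end IsBudgetData

/-! ### The clearing profiles of power utility and their limit -/

section Profiles

variable {c A η : ℝ}

/-- The constant is free of `η`: `e^{c/A}` bounds the state price and `1 + 1/c` the consumption. -/
theorem isClearingProfile_clearingLog (hc : 0 < c) (hA : 0 < A) (hη : η ∈ Set.Ioc (0 : ℝ) 1) :
    IsClearingProfile A (Real.exp (c / A) * (1 + 1 / c))
      (fun y => Real.exp (clearingLog c A η y))
      (fun y => Real.exp (-clearingLog c A η y / η) * Real.exp (clearingLog c A η y)) where
  Z_continuous := Real.continuous_exp.comp (continuous_clearingLog hc hA hη.1)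
  Z_antitone := fun _ _ h =>
    Real.exp_le_exp.2 ((clearingLog_strictAnti hc hA hη.1).antitone h)
  le_Z y := Real.exp_le_exp.2 (neg_div_le_clearingLog hc hA hη.1 y)
  Z_le y := by
    have h1 : Real.exp (clearingLog c A η y) ≤
        Real.exp (c / A) * Real.exp (max (-y) 0 / A) := by
      rw [← Real.exp_add]
      exact Real.exp_le_exp.2 (clearingLog_le hc hA hη.1 y)
    refine h1.trans ?_
    gcongr
    refine le_mul_of_one_le_right (Real.exp_pos _).le ?_
    have : 0 < 1 / c := by positivity
    linarith
  J_continuous := by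
    have := continuous_clearingLog hc hA hη.1
    fun_prop
  J_monotone := fun y y' h => by
    have h1 := (clearingLog_strictAnti hc hA hη.1).antitone h
    -- This is where `η ≤ 1` enters: `J = e^{-(1/η - 1) w}` increases as `w` decreases.
    have h2 : 1 ≤ 1 / η := by
      rw [le_div_iff₀ hη.1]
      linarith [hη.2]
    simp only [← Real.exp_add]
    apply Real.exp_le_exp.2
    have e (v : ℝ) : -v / η + v = -(1 / η - 1) * v := by ring
    rw [e, e]
    nlinarith
  J_nonneg y := by positivity
  J_le y := by
    have h1 : Real.exp (clearingLog c A η y) ≤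
        Real.exp (c / A) * Real.exp (max (-y) 0 / A) := by
      rw [← Real.exp_add]
      exact Real.exp_le_exp.2 (clearingLog_le hc hA hη.1 y)
    have h2 : Real.exp (-clearingLog c A η y / η) ≤ (1 + 1 / c) * (1 + |y|) := by
      refine (exp_neg_clearingLog_le hc hA hη.1 y).trans ?_
      have : max y 0 / c ≤ |y| / c := by
        gcongr
        exact max_le (le_abs_self y) (abs_nonneg y)
      have : 0 < 1 / c := by positivity
      have e : (1 + 1 / c) * (1 + |y|) = 1 + |y| / c + 1 / c + |y| := by ring
      linarith [abs_nonneg y]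
    calc _ ≤ (1 + 1 / c) * (1 + |y|) * (Real.exp (c / A) * Real.exp (max (-y) 0 / A)) := by
          gcongr
      _ = _ := by ring

theorem isClearingProfile_limit (hc : 0 < c) (hA : 0 < A) :
    IsClearingProfile A (Real.exp (c / A) * (1 + 1 / c))
      (fun y => Real.exp (max (-y) 0 / A)) (fun y => max y 0 / c) where
  Z_continuous := by fun_prop
  Z_antitone := fun _ _ h => by
    simp only
    gcongr
  le_Z y := by
    gcongr
    exact le_max_left _ _
  Z_le y := by
    refine le_mul_of_one_le_left (Real.exp_pos _).le ?_
    have : 0 < 1 / c := by positivity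
    have : 1 ≤ Real.exp (c / A) := Real.one_le_exp (by positivity)
    nlinarith
  J_continuous := by fun_prop
  J_monotone := fun _ _ h => by
    simp only
    gcongr
  J_nonneg y := by positivity
  J_le y := by
    have h1 : max y 0 / c ≤ |y| / c := by
      gcongr
      exact max_le (le_abs_self y) (abs_nonneg y)
    have h2 : 1 ≤ Real.exp (c / A) := Real.one_le_exp (by positivity)
    have h3 : 1 ≤ Real.exp (max (-y) 0 / A) := Real.one_le_exp (by positivity)
    have h4 : 0 < 1 / c := by positivity
    have h5 := abs_nonneg y
    calc max y 0 / c ≤ 1 * (1 + 1 / c) * ((1 + |y|) * 1) := by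
          have e : 1 * (1 + 1 / c) * ((1 + |y|) * 1) = 1 + |y| / c + 1 / c + |y| := by ring
          linarith
      _ ≤ _ := by gcongr

theorem tendsto_Z_clearingLog (hc : 0 < c) (hA : 0 < A) (y : ℝ) :
    Tendsto (fun η => Real.exp (clearingLog c A η y)) (𝓝[>] 0)
      (𝓝 (Real.exp (max (-y) 0 / A))) :=
  (Real.continuous_exp.tendsto _).comp (tendsto_clearingLog_nhdsGT hc hA y)

/-- A direct limit of `e^{-w/η}` is indeterminate when `w → 0`, so it is replaced by `(y + A w)/c`.
In the limit `y + y⁻ = y⁺`, and the factor `e^{y⁻/A}` equals `1` wherever `y⁺ ≠ 0`. -/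
theorem tendsto_J_clearingLog (hc : 0 < c) (hA : 0 < A) (y : ℝ) :
    Tendsto (fun η => Real.exp (-clearingLog c A η y / η) * Real.exp (clearingLog c A η y))
      (𝓝[>] 0) (𝓝 (max y 0 / c)) := by
  have h1 := tendsto_clearingLog_nhdsGT hc hA y
  have h2 := (((h1.const_mul A).const_add y).div_const c).mul (tendsto_Z_clearingLog hc hA y)
  have e : (y + A * (max (-y) 0 / A)) / c * Real.exp (max (-y) 0 / A) = max y 0 / c := by
    rw [mul_div_cancel₀ _ hA.ne']
    rcases le_total y 0 with h | h
    · rw [max_eq_left (by linarith), max_eq_right h]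
      simp
    · rw [max_eq_right (by linarith), max_eq_left h]
      simp
  rw [e] at h2
  refine h2.congr' ?_
  filter_upwards [self_mem_nhdsWithin] with η hη
  congr 1
  rw [div_eq_iff hc.ne']
  linarith [clearingLog_spec hc hA hη y]

end Profiles

/-! ### Existence and uniqueness of the budget constants, and passage to the limit under the
integral. -/

namespace IsBudgetData

variable {Ω : Type*} [MeasurableSpace Ω] {P : Measure Ω} [IsProbabilityMeasure P] {A : ℝ}
  {θ w e : Ω → ℝ} {c η : ℝ}

theorem existsUnique_budgetGap_clearingLog (hb : IsBudgetData P A θ w e) (hc : 0 < c)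
    (hη : η ∈ Set.Ioc (0 : ℝ) 1) :
    ∃! κ, budgetGap P θ w e (fun y => Real.exp (clearingLog c A η y))
      (fun y => Real.exp (-clearingLog c A η y / η) * Real.exp (clearingLog c A η y)) κ = 0 := by
  have hA := hb.A_pos
  have hp := isClearingProfile_clearingLog hc hA hη
  have hstrict := hb.budgetGap_strictAnti hp
    (fun _ _ h => Real.exp_lt_exp.2 (clearingLog_strictAnti hc hA hη.1 h))
  obtain ⟨κ, hκ⟩ := hb.exists_budgetGap_eq_zero hp
    (hb.exists_budgetGap_neg_of_tendsto_zero hp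
      (Real.tendsto_exp_atBot.comp (tendsto_clearingLog_atTop hc hA hη.1))
      fun y => by positivity)
  exact ⟨κ, hκ, fun k hk => hstrict.injective (hk.trans hκ.symm)⟩

theorem existsUnique_budgetGap_limit (hb : IsBudgetData P A θ w e) (hc : 0 < c) :
    ∃! κ, budgetGap P θ w e (fun y => Real.exp (max (-y) 0 / A)) (fun y => max y 0 / c) κ = 0 := by
  have hA := hb.A_pos
  have hp := isClearingProfile_limit hc hA
  have hneg : ∃ κ, budgetGap P θ w e (fun y => Real.exp (max (-y) 0 / A))
      (fun y => max y 0 / c) κ < 0 := by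
    have hw : Integrable w P := by
      refine hb.integrable.mono hb.aemeasurable_w.aestronglyMeasurable
        (Eventually.of_forall fun ω => ?_)
      rw [norm_mul]
      refine le_mul_of_one_le_left (norm_nonneg _) ?_
      rw [Real.norm_of_nonneg (Real.exp_pos _).le]
      have := hb.A_pos
      exact Real.one_le_exp (by positivity)
    have hθw : Integrable (fun ω => |θ ω| * w ω) P := by
      refine hb.integrable_θ.mono ?_ (Eventually.of_forall fun ω => ?_)
      · have := hb.aemeasurable_θ
        have := hb.aemeasurable_w
        exact AEMeasurable.aestronglyMeasurable (by fun_prop)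
      · simp only [norm_mul]
        gcongr
        refine le_mul_of_one_le_left (norm_nonneg _) ?_
        rw [Real.norm_of_nonneg (Real.exp_pos _).le]
        exact Real.one_le_exp (by positivity)
    -- The consumption value grows at least linearly in `κ`, because `(θ + κ)⁺ ≥ κ - |θ|`, and it
    -- overtakes the endowment value, which is bounded for `κ ≥ 0`.
    have hw0 := integral_pos_of_ae_pos hw (Eventually.of_forall hb.w_pos)
    have hlow : ∀ κ, (κ * ∫ ω, w ω ∂P - ∫ ω, |θ ω| * w ω ∂P) / c ≤
        ∫ ω, max (θ ω + κ) 0 / c * w ω ∂P := by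
      intro κ
      rw [← integral_const_mul, ← integral_sub (hw.const_mul κ) hθw, ← integral_div]
      refine integral_mono (((hw.const_mul κ).sub hθw).div_const c) (hb.integrable_J hp κ)
        fun ω => ?_
      have := hb.w_pos ω
      simp only
      rw [← sub_mul, mul_div_right_comm]
      gcongr
      exact le_max_of_le_left (by linarith [neg_abs_le (θ ω)])
    set N := ∫ ω, e ω * (Real.exp (max (-(θ ω + 0)) 0 / A) * w ω) ∂P with hN
    have hlim : Tendsto (fun κ => (κ * ∫ ω, w ω ∂P - ∫ ω, |θ ω| * w ω ∂P) / c) atTop atTop :=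
      (tendsto_atTop_add_const_right _ _ (tendsto_id.atTop_mul_const hw0)).atTop_div_const hc
    obtain ⟨κ, h1, h2⟩ := ((hlim.eventually_gt_atTop N).and (eventually_ge_atTop 0)).exists
    refine ⟨κ, ?_⟩
    have h3 := hb.integral_eZ_antitone hp h2
    have h4 := hlow κ
    simp only [budgetGap] at *
    linarith
  obtain ⟨κ, hκ⟩ := hb.exists_budgetGap_eq_zero hp hneg
  -- The two sides are only weakly monotone. Two roots `k < k'` would force equal consumption
  -- values, hence `θ + k' ≤ 0` almost surely; consumption at `k'` is then worth zero, whereas the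
  -- endowment has positive value.
  have key : ∀ k k', k < k' →
      budgetGap P θ w e (fun y => Real.exp (max (-y) 0 / A)) (fun y => max y 0 / c) k = 0 →
      budgetGap P θ w e (fun y => Real.exp (max (-y) 0 / A)) (fun y => max y 0 / c) k' = 0 →
      False := by
    intro k k' hk h1 h2
    have h3 := hb.integral_eZ_antitone hp hk.le
    have h4 := hb.integral_J_monotone hp hk.le
    have h5 := hb.integral_eZ_pos hp k'
    simp only [budgetGap] at h1 h2 h3 h4 h5
    have h6 : ∫ ω, (max (θ ω + k') 0 / c * w ω - max (θ ω + k) 0 / c * w ω) ∂P = 0 := by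
      rw [integral_sub (hb.integrable_J hp k') (hb.integrable_J hp k)]
      linarith
    have hnonneg : 0 ≤ fun ω => max (θ ω + k') 0 / c * w ω - max (θ ω + k) 0 / c * w ω := by
      intro ω
      have := hb.w_pos ω
      simp only [Pi.zero_apply, sub_nonneg]
      gcongr
    have h6 := (integral_eq_zero_iff_of_nonneg hnonneg
      ((hb.integrable_J hp k').sub (hb.integrable_J hp k))).1 h6
    have h7 : ∫ ω, max (θ ω + k') 0 / c * w ω ∂P = 0 := by
      rw [← integral_zero Ω ℝ (μ := P)]
      refine integral_congr_ae ?_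
      filter_upwards [h6] with ω h8
      have hw := hb.w_pos ω
      simp only [Pi.zero_apply, ← sub_mul, ← sub_div, mul_eq_zero, hw.ne', or_false,
        div_eq_zero_iff, hc.ne'] at h8
      have : θ ω + k' ≤ 0 := by
        by_contra! h9
        rw [max_eq_left h9.le] at h8
        rcases max_choice (θ ω + k) 0 with h | h <;> rw [h] at h8 <;> linarith
      simp [max_eq_right this]
    linarith
  refine ⟨κ, hκ, fun k hk => ?_⟩
  rcases lt_trichotomy k κ with h | h | h
  · exact (key k κ h hk hκ).elim
  · exact h
  · exact (key κ k h hκ hk).elim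

omit [IsProbabilityMeasure P] in
theorem tendsto_integral_Z_smul {E : Type*} [NormedAddCommGroup E] [NormedSpace ℝ E]
    (hb : IsBudgetData P A θ w e) (hc : 0 < c) {κ : ℝ → ℝ} {κ₀ : ℝ}
    (hκ : Tendsto κ (𝓝[>] 0) (𝓝 κ₀)) {f : Ω → E} (hf : AEStronglyMeasurable f P)
    (hfe : ∀ ω, ‖f ω‖ ≤ e ω) :
    Tendsto (fun η => ∫ ω, (Real.exp (clearingLog c A η (θ ω + κ η)) * w ω) • f ω ∂P) (𝓝[>] 0)
      (𝓝 (∫ ω, (Real.exp (max (-(θ ω + κ₀)) 0 / A) * w ω) • f ω ∂P)) := by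
  have hA := hb.A_pos
  have hη : ∀ᶠ η : ℝ in 𝓝[>] 0, η ∈ Set.Ioc (0 : ℝ) 1 := Ioc_mem_nhdsGT one_pos
  have hR : ∀ᶠ η in 𝓝[>] 0, |κ η| ≤ |κ₀| + 1 :=
    hκ.abs.eventually_le_const (by linarith)
  refine tendsto_integral_filter_of_dominated_convergence _
    (hη.mono fun η h => (hb.aestronglyMeasurable_Z (isClearingProfile_clearingLog hc hA h)
      (κ η)).smul hf) ?_ (hb.integrable_bound_eZ (Real.exp (c / A) * (1 + 1 / c)) (|κ₀| + 1)) ?_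
  · filter_upwards [hη, hR] with η h1 h2
    refine Eventually.of_forall fun ω => ?_
    rw [norm_smul, mul_comm]
    gcongr
    · exact (hfe ω).trans (le_abs_self _)
    · exact hb.norm_Z_le (isClearingProfile_clearingLog hc hA h1) h2 ω
  · refine Eventually.of_forall fun ω => ?_
    refine Tendsto.smul_const (Tendsto.mul_const _ ?_) _
    exact (Real.continuous_exp.tendsto _).comp
      (tendsto_clearingLog_of_tendsto hc hA (hκ.const_add (θ ω)))

end IsBudgetData

/-! ### Quadratic forms -/

section QuadraticForms

variable {d : ℕ}

theorem abs_dotProduct_ofLp_le (x : StateSpace d) (v : Fin d → ℝ) :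
    |x.ofLp ⬝ᵥ v| ≤ ‖x‖ * ‖(WithLp.toLp 2 v : StateSpace d)‖ := by
  have h := abs_real_inner_le_norm (WithLp.toLp 2 v : StateSpace d) x
  rw [EuclideanSpace.inner_eq_star_dotProduct] at h
  rw [mul_comm]
  simpa using h

theorem abs_quadratic_le (M : Matrix (Fin d) (Fin d) ℝ) (x : StateSpace d) :
    |x.ofLp ⬝ᵥ (M *ᵥ x.ofLp)| ≤ ‖Matrix.toEuclideanCLM (𝕜 := ℝ) M‖ * ‖x‖ ^ 2 := by
  have h1 := abs_dotProduct_ofLp_le x (M *ᵥ x.ofLp)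
  have h2 := (Matrix.toEuclideanCLM (𝕜 := ℝ) M).le_opNorm x
  rw [← Matrix.ofLp_toEuclideanCLM, WithLp.toLp_ofLp] at h1
  rw [← Matrix.ofLp_toEuclideanCLM]
  nlinarith [norm_nonneg x]

theorem continuous_quadratic (M : Matrix (Fin d) (Fin d) ℝ) :
    Continuous fun x : StateSpace d => x.ofLp ⬝ᵥ (M *ᵥ x.ofLp) := by
  have h : Continuous fun x : StateSpace d => x.ofLp := PiLp.continuous_ofLp 2 _
  exact h.dotProduct (continuous_const.matrix_mulVec h)

theorem continuous_dotProduct_ofLp (v : Fin d → ℝ) :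
    Continuous fun x : StateSpace d => x.ofLp ⬝ᵥ v := by
  have h : Continuous fun x : StateSpace d => x.ofLp := PiLp.continuous_ofLp 2 _
  exact h.dotProduct continuous_const

/-- `q` is the minimum of the form on the unit sphere; the sphere is empty when `d = 0`. -/
theorem Matrix.PosDef.exists_mul_sq_norm_le {M : Matrix (Fin d) (Fin d) ℝ} (hM : M.PosDef) :
    ∃ q > 0, ∀ x : StateSpace d, q * ‖x‖ ^ 2 ≤ x.ofLp ⬝ᵥ (M *ᵥ x.ofLp) := by
  have hpos : ∀ x : StateSpace d, x ≠ 0 → 0 < x.ofLp ⬝ᵥ (M *ᵥ x.ofLp) := by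
    intro x hx
    have h := hM.dotProduct_mulVec_pos (x := x.ofLp) (by simpa using hx)
    simpa using h
  have hunit : ∀ x : StateSpace d, x ≠ 0 → ‖x‖⁻¹ • x ∈ Metric.sphere (0 : StateSpace d) 1 := by
    intro x hx
    simp [norm_smul, hx]
  rcases (Metric.sphere (0 : StateSpace d) 1).eq_empty_or_nonempty with he | hne
  · refine ⟨1, one_pos, fun x => ?_⟩
    rcases eq_or_ne x 0 with rfl | hx
    · simp
    · have := hunit x hx
      simp [he] at this
  · obtain ⟨u, hu, hmin⟩ := (isCompact_sphere (0 : StateSpace d) 1).exists_isMinOn hne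
      (continuous_quadratic M).continuousOn
    have hu0 : u ≠ 0 := by
      rintro rfl
      simp at hu
    refine ⟨_, hpos u hu0, fun x => ?_⟩
    rcases eq_or_ne x 0 with rfl | hx
    · simp
    · have h := hmin (hunit x hx)
      simp only [Set.mem_ofPred_eq, WithLp.ofLp_smul, Matrix.mulVec_smul, dotProduct_smul,
        smul_dotProduct, smul_eq_mul] at h
      have hn : 0 < ‖x‖ := norm_pos_iff.2 hx
      rw [← mul_assoc, ← mul_inv, inv_mul_eq_div, le_div_iff₀ (by positivity), ← sq] at h
      exact h

/-- With `u = M⁻¹ x` and `v = (M + N)⁻¹ x`, expanding `(u - v)' M (u - v) ≥ 0` and using `v' M v =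
v' x - v' N v` gives `u' x ≥ v' x + v' N v`. It yields `P_I ≥ P_U`. -/
theorem Matrix.PosDef.quadratic_inv_add_le {M N : Matrix (Fin d) (Fin d) ℝ} (hM : M.PosDef)
    (hN : N.PosSemidef) (x : Fin d → ℝ) :
    x ⬝ᵥ ((M + N)⁻¹ *ᵥ x) ≤ x ⬝ᵥ (M⁻¹ *ᵥ x) := by
  have hMN : (M + N).PosDef := hM.add_posSemidef hN
  have hMdet : IsUnit M.det := (Matrix.isUnit_iff_isUnit_det _).1 hM.isUnit
  have hMNdet : IsUnit (M + N).det := (Matrix.isUnit_iff_isUnit_det _).1 hMN.isUnit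
  set u := M⁻¹ *ᵥ x with hu
  set v := (M + N)⁻¹ *ᵥ x with hv
  have hMu : M *ᵥ u = x := by
    rw [hu, Matrix.mulVec_mulVec, Matrix.mul_nonsing_inv _ hMdet, Matrix.one_mulVec]
  have hMNv : M *ᵥ v + N *ᵥ v = x := by
    rw [← Matrix.add_mulVec, hv, Matrix.mulVec_mulVec, Matrix.mul_nonsing_inv _ hMNdet,
      Matrix.one_mulVec]
  have h1 := hM.posSemidef.dotProduct_mulVec_nonneg (u - v)
  have h2 := hN.dotProduct_mulVec_nonneg v
  have hsymm : u ⬝ᵥ (M *ᵥ v) = v ⬝ᵥ (M *ᵥ u) := by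
    have hT : Mᵀ = M := by simpa using hM.isHermitian.eq
    rw [Matrix.dotProduct_mulVec, ← Matrix.mulVec_transpose, hT, dotProduct_comm]
  simp only [star_trivial, Matrix.mulVec_sub, dotProduct_sub, sub_dotProduct] at h1 h2
  rw [hsymm, hMu] at h1
  have h3 : v ⬝ᵥ (M *ᵥ v) + v ⬝ᵥ (N *ᵥ v) = v ⬝ᵥ x := by rw [← dotProduct_add, hMNv]
  rw [dotProduct_comm x v, dotProduct_comm x u]
  linarith

end QuadraticForms

/-! ### Power utility -/

theorem deriv_crraUtility {η w : ℝ} (hη : η ∈ Set.Ioc (0 : ℝ) 1) (hw : 0 < w) :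
    deriv (crraUtility η) w = Real.exp (-η * Real.log w) := by
  rcases eq_or_ne η 1 with rfl | h1
  · have : crraUtility 1 = Real.log := by
      funext v
      simp [crraUtility]
    rw [this, Real.deriv_log, neg_one_mul, Real.exp_neg, Real.exp_log hw]
  · have : crraUtility η = fun v => v ^ (1 - η) / (1 - η) := by
      funext v
      simp [crraUtility, h1]
    have h2 : 1 - η ≠ 0 := sub_ne_zero.2 h1.symm
    rw [this]
    have h3 := ((Real.hasDerivAt_rpow_const (p := 1 - η) (Or.inl hw.ne')).div_const
      (1 - η)).deriv
    rw [h3, mul_div_cancel_left₀ _ h2, Real.rpow_def_of_pos hw]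
    congr 1
    ring

theorem inverseMarginal_crraUtility {η : ℝ} (hη : η ∈ Set.Ioc (0 : ℝ) 1) (w : ℝ) :
    inverseMarginal (crraUtility η) (Real.exp w) = Real.exp (-w / η) := by
  have hinj : Set.InjOn (deriv (crraUtility η)) (Set.Ioi 0) := by
    intro u hu v hv h
    rw [deriv_crraUtility hη hu, deriv_crraUtility hη hv, Real.exp_eq_exp] at h
    exact Real.log_injOn_pos hu hv (mul_left_cancel₀ (neg_ne_zero.2 hη.1.ne') h)
  have h := hinj.leftInvOn_invFunOn (Set.mem_Ioi.2 (Real.exp_pos (-w / η)))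
  rw [deriv_crraUtility hη (Real.exp_pos _), Real.log_exp] at h
  rw [inverseMarginal, ← h]
  congr 2
  have := hη.1.ne'
  field_simp

/-! ### Change of measure -/

section DensityChange

variable {Ω : Type*} [MeasurableSpace Ω] {P : Measure Ω} {g : Ω → ℝ}

theorem isProbabilityMeasure_withDensity_div [NeZero P] (hg : Integrable g P) (hpos : ∀ ω, 0 < g ω) :
    IsProbabilityMeasure (P.withDensity fun ω => ENNReal.ofReal (g ω / ∫ ω', g ω' ∂P)) := by
  have h0 := integral_pos_of_ae_pos hg (Eventually.of_forall hpos)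
  constructor
  rw [withDensity_apply _ MeasurableSet.univ, setLIntegral_univ,
    ← ofReal_integral_eq_lintegral_ofReal (hg.div_const _)
      (Eventually.of_forall fun ω => (div_pos (hpos ω) h0).le),
    integral_div, div_self h0.ne', ENNReal.ofReal_one]

theorem integral_withDensity_div {E : Type*} [NormedAddCommGroup E] [NormedSpace ℝ E] [NeZero P]
    (hg : Integrable g P) (hpos : ∀ ω, 0 < g ω) (f : Ω → E) :
    ∫ ω, f ω ∂(P.withDensity fun ω => ENNReal.ofReal (g ω / ∫ ω', g ω' ∂P)) =
      (∫ ω, g ω ∂P)⁻¹ • ∫ ω, g ω • f ω ∂P := by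
  have h0 := integral_pos_of_ae_pos hg (Eventually.of_forall hpos)
  rw [integral_withDensity_eq_integral_toReal_smul₀
    (hg.div_const _).aestronglyMeasurable.aemeasurable.ennreal_ofReal
    (Eventually.of_forall fun _ => ENNReal.ofReal_lt_top), ← integral_smul]
  refine integral_congr_ae (Eventually.of_forall fun ω => ?_)
  simp only
  rw [ENNReal.toReal_ofReal (div_pos (hpos ω) h0).le, smul_smul, inv_mul_eq_div]

theorem integrable_withDensity_div {E : Type*} [NormedAddCommGroup E] [NormedSpace ℝ E] [NeZero P]
    (hg : Integrable g P) (hpos : ∀ ω, 0 < g ω) {f : Ω → E}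
    (hf : Integrable (fun ω => g ω • f ω) P) :
    Integrable f (P.withDensity fun ω => ENNReal.ofReal (g ω / ∫ ω', g ω' ∂P)) := by
  have h0 := integral_pos_of_ae_pos hg (Eventually.of_forall hpos)
  have hmeas : AEMeasurable (fun ω => (g ω / ∫ ω', g ω' ∂P).toNNReal) P :=
    (hg.div_const _).aestronglyMeasurable.aemeasurable.real_toNNReal
  refine (integrable_withDensity_iff_integrable_smul₀ hmeas).2 ?_
  refine (hf.smul (∫ ω', g ω' ∂P)⁻¹).congr (Eventually.of_forall fun ω => ?_)
  simp only [Pi.smul_apply]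
  rw [NNReal.smul_def, Real.coe_toNNReal _ (div_pos (hpos ω) h0).le, smul_smul, inv_mul_eq_div]

end DensityChange

namespace Economy

variable {d : ℕ} {E : Economy d}

/-! ### Bounds on the weights -/

theorem AgentAssumption.αI_pos (hE : E.AgentAssumption) : 0 < E.αI := div_pos hE.ωI_pos hE.γI_pos

theorem AgentAssumption.αN_pos (hE : E.AgentAssumption) : 0 < E.αN := div_pos hE.ωN_pos hE.γN_pos

theorem AgentAssumption.tolerance_pos (hE : E.AgentAssumption) : 0 < E.αI + E.αN :=
  add_pos hE.αI_pos hE.αN_pos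

theorem AgentAssumption.PU_posDef (hE : E.AgentAssumption) : E.PU.PosDef :=
  (hE.CI_posDef.add_posSemidef (hE.CN_posDef.posSemidef.smul (sq_nonneg _))).inv

theorem AgentAssumption.quadratic_sub_nonneg (hE : E.AgentAssumption) (x : Fin d → ℝ) :
    0 ≤ x ⬝ᵥ ((E.PI - E.PU) *ᵥ x) := by
  rw [Matrix.sub_mulVec, dotProduct_sub, sub_nonneg]
  exact hE.CI_posDef.quadratic_inv_add_le (hE.CN_posDef.posSemidef.smul (sq_nonneg _)) x

theorem signalWeight_pos (x h : StateSpace d) : 0 < E.signalWeight x h := Real.exp_pos _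

theorem continuous_signalWeight (h : StateSpace d) :
    Continuous fun x => E.signalWeight x h := by
  have h1 := continuous_quadratic E.PU
  have h2 := continuous_dotProduct_ofLp (E.PU *ᵥ h.ofLp)
  unfold signalWeight
  fun_prop

theorem PayoffAssumption.continuous_vartheta (hΨ : E.PayoffAssumption) (h : StateSpace d) :
    Continuous fun x => E.vartheta x h := by
  have h1 := continuous_quadratic (E.PI - E.PU)
  have h2 := continuous_dotProduct_ofLp (E.PI *ᵥ E.μN.ofLp)
  have h3 := continuous_dotProduct_ofLp
    (((E.αI + E.αN * E.τN) • E.PI - (E.αI + E.αN) • E.PU) *ᵥ h.ofLp)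
  have h4 := hΨ.contDiff.continuous
  unfold vartheta
  fun_prop

/-- The payoff term and the quadratic term of `ϑ` are nonnegative; what remains is linear in `x`. -/
theorem exists_neg_vartheta_le (hΨ : E.PayoffAssumption) (hE : E.AgentAssumption)
    (h : StateSpace d) : ∃ k, 0 ≤ k ∧ ∀ x, -E.vartheta x h ≤ k * ‖x‖ := by
  set v := E.PI *ᵥ E.μN.ofLp with hv
  set u := ((E.αI + E.αN * E.τN) • E.PI - (E.αI + E.αN) • E.PU) *ᵥ h.ofLp with hu
  have hαN := hE.αN_pos
  have hA := hE.tolerance_pos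
  refine ⟨E.αN * ‖(WithLp.toLp 2 v : StateSpace d)‖ + ‖(WithLp.toLp 2 u : StateSpace d)‖,
    by positivity, fun x => ?_⟩
  have h1 := (le_abs_self _).trans (abs_dotProduct_ofLp_le x v)
  have h2 := (le_abs_self _).trans (abs_dotProduct_ofLp_le x u)
  have h3 := hΨ.supply_pos x
  have h4 := hE.quadratic_sub_nonneg x.ofLp
  have h5 : 0 ≤ 1 / 2 * (E.αI + E.αN) * (x.ofLp ⬝ᵥ ((E.PI - E.PU) *ᵥ x.ofLp)) := by positivity
  have h6 := mul_le_mul_of_nonneg_left h1 hαN.le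
  simp only [vartheta, ← hv, ← hu]
  linarith

theorem exists_abs_vartheta_le (hΨ : E.PayoffAssumption) (h : StateSpace d) :
    ∃ C m, 0 ≤ C ∧ ∀ x, |E.vartheta x h| ≤ C * Real.exp (m * (1 + ‖x‖)) := by
  obtain ⟨K, hK, hg⟩ := hΨ.growth
  set v := E.PI *ᵥ E.μN.ofLp with hv
  set u := ((E.αI + E.αN * E.τN) • E.PI - (E.αI + E.αN) • E.PU) *ᵥ h.ofLp with hu
  set Q := ‖Matrix.toEuclideanCLM (𝕜 := ℝ) (E.PI - E.PU)‖ with hQ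
  refine ⟨‖E.supply‖ + |E.αN| * ‖(WithLp.toLp 2 v : StateSpace d)‖ +
    |1 / 2 * (E.αI + E.αN)| * Q + ‖(WithLp.toLp 2 u : StateSpace d)‖, K + 2, by positivity,
    fun x => ?_⟩
  have hx := norm_nonneg x
  -- The extra `2` in the rate lets the same exponential dominate `‖x‖` and `‖x‖ ^ 2` as well as the
  -- payoff.
  set D := Real.exp ((K + 2) * (1 + ‖x‖)) with hD
  have e1 : ‖E.Ψ x‖ ≤ D := (hg x).1.trans (Real.exp_le_exp.2 (by nlinarith))
  have e2 : ‖x‖ ≤ D := by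
    have h1 := Real.add_one_le_exp ‖x‖
    have h2 : Real.exp ‖x‖ ≤ D := Real.exp_le_exp.2 (by nlinarith)
    linarith
  have e3 : ‖x‖ ^ 2 ≤ D := by
    have h1 := Real.add_one_le_exp ‖x‖
    have h2 : Real.exp ‖x‖ ^ 2 ≤ D := by
      rw [← Real.exp_nat_mul]
      exact Real.exp_le_exp.2 (by push_cast; nlinarith)
    exact (pow_le_pow_left₀ hx (by linarith) 2).trans h2
  have t1 : |inner ℝ E.supply (E.Ψ x)| ≤ ‖E.supply‖ * D :=
    (abs_real_inner_le_norm _ _).trans (by gcongr)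
  have t2 : |E.αN * (x.ofLp ⬝ᵥ v)| ≤ |E.αN| * ‖(WithLp.toLp 2 v : StateSpace d)‖ * D := by
    rw [abs_mul, mul_assoc, mul_comm ‖_‖]
    gcongr
    exact (abs_dotProduct_ofLp_le x v).trans (by gcongr)
  have t3 : |1 / 2 * (E.αI + E.αN) * (x.ofLp ⬝ᵥ ((E.PI - E.PU) *ᵥ x.ofLp))| ≤
      |1 / 2 * (E.αI + E.αN)| * Q * D := by
    rw [abs_mul, mul_assoc]
    gcongr
    exact (abs_quadratic_le _ x).trans (by gcongr)
  have t4 : |x.ofLp ⬝ᵥ u| ≤ ‖(WithLp.toLp 2 u : StateSpace d)‖ * D := by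
    rw [mul_comm]
    exact (abs_dotProduct_ofLp_le x u).trans (by gcongr)
  simp only [vartheta, ← hv, ← hu]
  refine (abs_sub _ _).trans ?_
  refine (add_le_add_left (abs_add_le _ _) _).trans ?_
  refine (add_le_add_left (add_le_add_left (abs_sub _ _) _) _).trans ?_
  rw [add_mul, add_mul, add_mul]
  gcongr

theorem exists_exp_mul_weight_le (hΨ : E.PayoffAssumption) (hE : E.AgentAssumption)
    (h : StateSpace d) (m : ℝ) :
    ∃ M, ∀ x, Real.exp (m * (1 + ‖x‖)) *
      (Real.exp (max (-E.vartheta x h) 0 / (E.αI + E.αN)) * E.signalWeight x h) ≤ M := by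
  obtain ⟨k, hk, hϑ⟩ := exists_neg_vartheta_le hΨ hE h
  obtain ⟨q, hq, hPU⟩ := hE.PU_posDef.exists_mul_sq_norm_le
  have hA := hE.tolerance_pos
  set A := E.αI + E.αN with hAdef
  set u := E.PU *ᵥ h.ofLp with hu
  set a := m + k / A + ‖(WithLp.toLp 2 u : StateSpace d)‖ with ha
  -- The exponent is at most `m + a r - q r²/2` with `r = ‖x‖`; completing the square gives the
  -- bound.
  refine ⟨Real.exp (m + a ^ 2 / (2 * q)), fun x => ?_⟩
  have hx := norm_nonneg x
  rw [signalWeight, ← Real.exp_add, ← Real.exp_add]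
  apply Real.exp_le_exp.2
  have h1 : max (-E.vartheta x h) 0 / A ≤ k / A * ‖x‖ := by
    rw [div_mul_eq_mul_div]
    gcongr
    exact max_le (hϑ x) (by positivity)
  have h2 := hPU x
  have h3 := (le_abs_self _).trans (abs_dotProduct_ofLp_le x u)
  have h4 : a * ‖x‖ - 1 / 2 * (q * ‖x‖ ^ 2) ≤ a ^ 2 / (2 * q) := by
    rw [le_div_iff₀ (by positivity)]
    nlinarith [sq_nonneg (a - q * ‖x‖)]
  have h5 : a * ‖x‖ = m * ‖x‖ + k / A * ‖x‖ + ‖(WithLp.toLp 2 u : StateSpace d)‖ * ‖x‖ := by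
    rw [ha]; ring
  rw [← hu]
  linarith

variable {Ω : Type*} [MeasurableSpace Ω] {P : Measure Ω} [IsProbabilityMeasure P]

theorem isBudgetData (hΨ : E.PayoffAssumption) (hE : E.AgentAssumption) (h : StateSpace d)
    {Y : Ω → StateSpace d} (hY : AEMeasurable Y P) {e : Ω → ℝ} (he : AEMeasurable e P)
    (hpos : ∀ᵐ ω ∂P, 0 < e ω) {C m : ℝ}
    (hle : ∀ ω, |e ω| ≤ C * Real.exp (m * (1 + ‖Y ω‖))) :
    IsBudgetData P (E.αI + E.αN) (fun ω => E.vartheta (Y ω) h)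
      (fun ω => E.signalWeight (Y ω) h) e := by
  have hϑ : AEMeasurable (fun ω => E.vartheta (Y ω) h) P :=
    (hΨ.continuous_vartheta h).measurable.comp_aemeasurable hY
  have hw : AEMeasurable (fun ω => E.signalWeight (Y ω) h) P :=
    (continuous_signalWeight h).measurable.comp_aemeasurable hY
  have hint : ∀ (f : Ω → ℝ) (C m : ℝ), AEMeasurable f P →
      (∀ ω, |f ω| ≤ C * Real.exp (m * (1 + ‖Y ω‖))) →
      Integrable (fun ω => f ω * (Real.exp (max (-E.vartheta (Y ω) h) 0 / (E.αI + E.αN)) *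
        E.signalWeight (Y ω) h)) P := by
    intro f C m hf hfle
    obtain ⟨M, hM⟩ := exists_exp_mul_weight_le hΨ hE h m
    refine Integrable.of_bound (C := |C| * M)
      (AEMeasurable.aestronglyMeasurable (by fun_prop)) (Eventually.of_forall fun ω => ?_)
    have hW := E.signalWeight_pos (Y ω) h
    set W := Real.exp (max (-E.vartheta (Y ω) h) 0 / (E.αI + E.αN)) * E.signalWeight (Y ω) h
      with hWdef
    have hW0 : 0 < W := by positivity
    rw [norm_mul, Real.norm_of_nonneg hW0.le, Real.norm_eq_abs]
    calc |f ω| * W ≤ |C| * Real.exp (m * (1 + ‖Y ω‖)) * W := by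
          gcongr
          exact (hfle ω).trans (by gcongr; exact le_abs_self C)
      _ = |C| * (Real.exp (m * (1 + ‖Y ω‖)) * W) := by ring
      _ ≤ _ := by gcongr; exact hM (Y ω)
  obtain ⟨C', m', -, hϑle⟩ := exists_abs_vartheta_le hΨ h
  exact
    { A_pos := hE.tolerance_pos
      aemeasurable_θ := hϑ
      aemeasurable_w := hw
      aemeasurable_e := he
      w_pos := fun ω => E.signalWeight_pos _ _
      e_pos := hpos
      integrable := by simpa using hint (fun _ => 1) 1 0 aemeasurable_const (by simp)
      integrable_e := hint e C m he hle
      integrable_θ := hint _ C' m' (by fun_prop) fun ω => by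
        rw [abs_abs]
        exact hϑle _ }

theorem isBudgetData_endowU (hΨ : E.PayoffAssumption) (hE : E.AgentAssumption) (h : StateSpace d)
    {Y : Ω → StateSpace d} (hY : AEMeasurable Y P)
    (hpos : ∀ᵐ ω ∂P, 0 < inner ℝ E.endowU (E.Ψ (Y ω))) :
    IsBudgetData P (E.αI + E.αN) (fun ω => E.vartheta (Y ω) h)
      (fun ω => E.signalWeight (Y ω) h) (fun ω => inner ℝ E.endowU (E.Ψ (Y ω))) := by
  obtain ⟨K, hK, hg⟩ := hΨ.growth
  have hΨc := hΨ.contDiff.continuous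
  refine isBudgetData hΨ hE h hY (C := ‖E.endowU‖) (m := K) ?_ hpos fun ω => ?_
  · exact (Continuous.measurable (f := fun x => inner ℝ E.endowU (E.Ψ x)) (by fun_prop)).comp_aemeasurable hY
  · exact (abs_real_inner_le_norm _ _).trans (by gcongr; exact (hg _).1)

/-- A fictitious endowment that dominates both the payoff and the constant `1`, so that one instance
controls numerator and denominator of the price. -/
theorem isBudgetData_norm (hΨ : E.PayoffAssumption) (hE : E.AgentAssumption) (h : StateSpace d)
    {Y : Ω → StateSpace d} (hY : AEMeasurable Y P) :
    IsBudgetData P (E.αI + E.αN) (fun ω => E.vartheta (Y ω) h)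
      (fun ω => E.signalWeight (Y ω) h) (fun ω => ‖E.Ψ (Y ω)‖ + 1) := by
  obtain ⟨K, hK, hg⟩ := hΨ.growth
  have hΨc := hΨ.contDiff.continuous
  refine isBudgetData hΨ hE h hY (C := 2) (m := K) ?_ ?_ fun ω => ?_
  · exact (Continuous.measurable (f := fun x => ‖E.Ψ x‖ + 1) (by fun_prop)).comp_aemeasurable hY
  · exact Eventually.of_forall fun ω => by positivity
  · rw [abs_of_nonneg (by positivity)]
    have h1 := (hg (Y ω)).1
    have h2 : 1 ≤ Real.exp (K * (1 + ‖Y ω‖)) := Real.one_le_exp (by positivity)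
    linarith

/-! ### The clearing and budget equations -/

theorem solvesClearing_iff (hE : E.AgentAssumption) {η : ℝ} (hη : η ∈ Set.Ioc (0 : ℝ) 1)
    (x h : StateSpace d) (κ z : ℝ) :
    E.SolvesClearing (crraUtility η) x h κ z ↔
      z = Real.exp (clearingLog E.ωU (E.αI + E.αN) η (E.vartheta x h + κ)) := by
  constructor
  · rintro ⟨hz, heq⟩
    rw [← Real.exp_log hz, inverseMarginal_crraUtility hη, Real.log_exp] at heq
    rw [← heq, clearingLog_eq hE.ωU_pos hE.tolerance_pos hη.1, Real.exp_log hz]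
  · rintro rfl
    refine ⟨Real.exp_pos _, ?_⟩
    rw [inverseMarginal_crraUtility hη, Real.log_exp]
    exact clearingLog_spec hE.ωU_pos hE.tolerance_pos hη.1 _

theorem existsUnique_solvesClearing (hE : E.AgentAssumption) {η : ℝ}
    (hη : η ∈ Set.Ioc (0 : ℝ) 1) (x h : StateSpace d) (κ : ℝ) :
    ∃! z, E.SolvesClearing (crraUtility η) x h κ z := by
  simp only [solvesClearing_iff hE hη, existsUnique_eq]

theorem clearingZ_crraUtility (hE : E.AgentAssumption) {η : ℝ} (hη : η ∈ Set.Ioc (0 : ℝ) 1)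
    (x h : StateSpace d) (κ : ℝ) :
    E.clearingZ (crraUtility η) x h κ =
      Real.exp (clearingLog E.ωU (E.αI + E.αN) η (E.vartheta x h + κ)) :=
  (solvesClearing_iff hE hη x h κ _).1
    (Classical.epsilon_spec (existsUnique_solvesClearing hE hη x h κ).exists)

theorem solvesBudget_iff (hE : E.AgentAssumption) {h : StateSpace d} {XT : Ω → StateSpace d}
    (hb : IsBudgetData P (E.αI + E.αN) (fun ω => E.vartheta (XT ω) h)
      (fun ω => E.signalWeight (XT ω) h) (fun ω => inner ℝ E.endowU (E.Ψ (XT ω))))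
    {η : ℝ} (hη : η ∈ Set.Ioc (0 : ℝ) 1) (κ : ℝ) :
    E.SolvesBudget P XT (crraUtility η) h κ ↔
      budgetGap P (fun ω => E.vartheta (XT ω) h) (fun ω => E.signalWeight (XT ω) h)
        (fun ω => inner ℝ E.endowU (E.Ψ (XT ω)))
        (fun y => Real.exp (clearingLog E.ωU (E.αI + E.αN) η y))
        (fun y => Real.exp (-clearingLog E.ωU (E.αI + E.αN) η y / η) *
          Real.exp (clearingLog E.ωU (E.αI + E.αN) η y)) κ = 0 := by
  have hp := isClearingProfile_clearingLog hE.ωU_pos hE.tolerance_pos hη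
  have h1 := hb.integrable_eZ hp κ
  have h2 := hb.integrable_J hp κ
  have h3 := hb.integrable_Z hp κ
  have h4 := hb.integral_Z_pos hp κ
  simp only [SolvesBudget, clearingZ_crraUtility hE hη, inverseMarginal_crraUtility hη,
    sub_mul, ← mul_assoc] at *
  rw [budgetGap, integral_sub h1 h2, eq_comm, div_eq_zero_iff]
  simp only [h3, h4.ne', or_false, true_and, ← mul_assoc]
  exact and_iff_right (h1.sub h2)

theorem limitWeight_eq (h : StateSpace d) (κ : ℝ) (x : StateSpace d) :
    E.limitWeight h κ x =
      Real.exp (max (-(E.vartheta x h + κ)) 0 / (E.αI + E.αN)) * E.signalWeight x h := by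
  rw [limitWeight, signalWeight, ← Real.exp_add]
  congr 1
  ring

/-- Clearing the denominator is harmless: if it vanished, the quotient would be `0` by convention,
not `1 / ω_U`, and a zero gap would contradict the positive endowment value. -/
theorem solvesLimit_iff (hE : E.AgentAssumption) {h : StateSpace d} {XT : Ω → StateSpace d}
    (hb : IsBudgetData P (E.αI + E.αN) (fun ω => E.vartheta (XT ω) h)
      (fun ω => E.signalWeight (XT ω) h) (fun ω => inner ℝ E.endowU (E.Ψ (XT ω)))) (κ : ℝ) :
    E.SolvesLimit P XT h κ ↔
      budgetGap P (fun ω => E.vartheta (XT ω) h) (fun ω => E.signalWeight (XT ω) h)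
        (fun ω => inner ℝ E.endowU (E.Ψ (XT ω)))
        (fun y => Real.exp (max (-y) 0 / (E.αI + E.αN))) (fun y => max y 0 / E.ωU) κ = 0 := by
  have hc := hE.ωU_pos
  have hp := isClearingProfile_limit hc hE.tolerance_pos
  have h1 := hb.integrable_eZ hp κ
  have h2 := hb.integrable_J hp κ
  have h3 := hb.integral_eZ_pos hp κ
  simp only [div_mul_eq_mul_div] at h2
  have h2' : Integrable (fun ω => max (E.vartheta (XT ω) h + κ) 0 * E.signalWeight (XT ω) h) P :=
    (h2.const_mul E.ωU).congr (Eventually.of_forall fun ω => by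
      simp only
      field_simp)
  simp only [SolvesLimit, limitWeight_eq, budgetGap, h1, h2', true_and, div_mul_eq_mul_div,
    integral_div, sub_eq_zero]
  set N := ∫ ω, inner ℝ E.endowU (E.Ψ (XT ω)) *
    (Real.exp (max (-(E.vartheta (XT ω) h + κ)) 0 / (E.αI + E.αN)) * E.signalWeight (XT ω) h) ∂P
  set D := ∫ ω, max (E.vartheta (XT ω) h + κ) 0 * E.signalWeight (XT ω) h ∂P
  constructor
  · intro heq
    have hD : D ≠ 0 := by
      intro h0
      rw [h0, div_zero] at heq
      exact (one_div_pos.2 hc).ne' heq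
    field_simp at heq ⊢
    linarith
  · intro heq
    have hD : D ≠ 0 := by
      intro h0
      rw [h0, zero_div] at heq
      exact h3.ne' heq
    field_simp at heq ⊢
    linarith

/-! ### Prices -/

/-- The normalization of `checkZ` by the law of `XT` is a nonzero constant and cancels in the
density. -/
theorem pricingMeasure_eq (hE : E.AgentAssumption) {h : StateSpace d} {XT Y : Ω → StateSpace d}
    (hb : IsBudgetData P (E.αI + E.αN) (fun ω => E.vartheta (XT ω) h)
      (fun ω => E.signalWeight (XT ω) h) (fun ω => inner ℝ E.endowU (E.Ψ (XT ω))))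
    {η : ℝ} (hη : η ∈ Set.Ioc (0 : ℝ) 1) :
    E.pricingMeasure P XT (crraUtility η) h Y = P.withDensity fun ω => ENNReal.ofReal
      (Real.exp (clearingLog E.ωU (E.αI + E.αN) η
          (E.vartheta (Y ω) h + E.kappaHat P XT (crraUtility η) h)) * E.signalWeight (Y ω) h /
        ∫ ω', Real.exp (clearingLog E.ωU (E.αI + E.αN) η
          (E.vartheta (Y ω') h + E.kappaHat P XT (crraUtility η) h)) *
          E.signalWeight (Y ω') h ∂P) := by
  have hp := isClearingProfile_clearingLog hE.ωU_pos hE.tolerance_pos hη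
  have h0 := (hb.integral_Z_pos hp (E.kappaHat P XT (crraUtility η) h)).ne'
  simp only [pricingMeasure, checkZ, clearingZ_crraUtility hE hη, integral_div]
  simp only [div_div_div_cancel_right₀ h0]

end Economy

theorem IsStrongSolution.aemeasurable {Ω : Type*} [MeasurableSpace Ω] {P : Measure Ω} {d : ℕ}
    {B : ℝ≥0 → Ω → StateSpace d} {b : StateSpace d → StateSpace d}
    {a : StateSpace d → Matrix (Fin d) (Fin d) ℝ} {T t₀ : ℝ≥0} {x : StateSpace d}
    {X : ℝ≥0 → Ω → StateSpace d} (hX : IsStrongSolution P B b a T t₀ x X)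
    (hB : IsBrownianMotion B P) {s : ℝ≥0} (hs : s ∈ Set.Icc t₀ T) : AEMeasurable (X s) P := by
  obtain ⟨g, hg, hXg⟩ := hX.adapted s hs
  have hle : pastSigma B s ≤ ‹MeasurableSpace Ω› :=
    iSup₂_le fun u _ => (hB.measurable u).comap_le
  exact ⟨g, hg.mono hle le_rfl, hXg⟩

/-! ### Well-posedness and convergence of the pricing function. -/

namespace Economy

variable {d : ℕ} {E : Economy d} {Ω : Type*} [MeasurableSpace Ω] {P : Measure Ω}
  [IsProbabilityMeasure P] {h : StateSpace d} {XT : Ω → StateSpace d}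

theorem existsUnique_solvesBudget (hE : E.AgentAssumption)
    (hb : IsBudgetData P (E.αI + E.αN) (fun ω => E.vartheta (XT ω) h)
      (fun ω => E.signalWeight (XT ω) h) (fun ω => inner ℝ E.endowU (E.Ψ (XT ω))))
    {η : ℝ} (hη : η ∈ Set.Ioc (0 : ℝ) 1) :
    ∃! κ, E.SolvesBudget P XT (crraUtility η) h κ := by
  simp only [solvesBudget_iff hE hb hη]
  exact hb.existsUnique_budgetGap_clearingLog hE.ωU_pos hη

theorem existsUnique_solvesLimit (hE : E.AgentAssumption)
    (hb : IsBudgetData P (E.αI + E.αN) (fun ω => E.vartheta (XT ω) h)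
      (fun ω => E.signalWeight (XT ω) h) (fun ω => inner ℝ E.endowU (E.Ψ (XT ω)))) :
    ∃! κ, E.SolvesLimit P XT h κ := by
  simp only [solvesLimit_iff hE hb]
  exact hb.existsUnique_budgetGap_limit hE.ωU_pos

theorem tendsto_kappaHat (hE : E.AgentAssumption)
    (hb : IsBudgetData P (E.αI + E.αN) (fun ω => E.vartheta (XT ω) h)
      (fun ω => E.signalWeight (XT ω) h) (fun ω => inner ℝ E.endowU (E.Ψ (XT ω)))) :
    Tendsto (fun η => E.kappaHat P XT (crraUtility η) h) (𝓝[>] 0)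
      (𝓝 (E.kappaHatZero P XT h)) := by
  have hc := hE.ωU_pos
  have hA := hE.tolerance_pos
  have hη : ∀ᶠ η : ℝ in 𝓝[>] 0, η ∈ Set.Ioc (0 : ℝ) 1 := Ioc_mem_nhdsGT one_pos
  have hlim := existsUnique_solvesLimit hE hb
  have hspec : E.SolvesLimit P XT h (E.kappaHatZero P XT h) := Classical.epsilon_spec hlim.exists
  refine hb.tendsto_root (isClearingProfile_limit hc hA)
    (hη.mono fun η h => isClearingProfile_clearingLog hc hA h)
    (tendsto_Z_clearingLog hc hA) (tendsto_J_clearingLog hc hA) (hη.mono fun η h => ?_)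
    ((solvesLimit_iff hE hb _).1 hspec)
    (fun k hk => hlim.unique ((solvesLimit_iff hE hb _).2 hk) hspec)
  exact (solvesBudget_iff hE hb h _).1
    (Classical.epsilon_spec (existsUnique_solvesBudget hE hb h).exists)

theorem tendsto_price (hΨ : E.PayoffAssumption) (hE : E.AgentAssumption)
    (hb : IsBudgetData P (E.αI + E.αN) (fun ω => E.vartheta (XT ω) h)
      (fun ω => E.signalWeight (XT ω) h) (fun ω => inner ℝ E.endowU (E.Ψ (XT ω))))
    {Y : Ω → StateSpace d} (hY : AEMeasurable Y P) :
    Tendsto (fun η => E.price P XT (crraUtility η) h Y) (𝓝[>] 0) (𝓝 (E.limitPrice P XT h Y)) := by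
  have hc := hE.ωU_pos
  have hA := hE.tolerance_pos
  have hbY := isBudgetData_norm hΨ hE h hY
  have hη : ∀ᶠ η : ℝ in 𝓝[>] 0, η ∈ Set.Ioc (0 : ℝ) 1 := Ioc_mem_nhdsGT one_pos
  have hκ := tendsto_kappaHat hE hb
  have hΨY : AEStronglyMeasurable (fun ω => E.Ψ (Y ω)) P :=
    (hΨ.contDiff.continuous.measurable.comp_aemeasurable hY).aestronglyMeasurable
  have h1 := hbY.tendsto_integral_Z_smul hc hκ hΨY fun ω => by linarith
  have h2 := hbY.tendsto_integral_Z_smul hc hκ (f := fun _ => (1 : ℝ))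
    aestronglyMeasurable_const fun ω => by simp
  simp only [smul_eq_mul, mul_one] at h2
  have h0 := hbY.integral_Z_pos (isClearingProfile_limit hc hA) (E.kappaHatZero P XT h)
  have h3 := (h2.inv₀ h0.ne').smul h1
  simp only [limitPrice, limitWeight_eq]
  refine h3.congr' ?_
  filter_upwards [hη] with η hη
  rw [price, pricingMeasure_eq hE hb hη, integral_withDensity_div
    (hbY.integrable_Z (isClearingProfile_clearingLog hc hA hη) _)
    fun ω => mul_pos (Real.exp_pos _) (E.signalWeight_pos _ _)]

theorem integrable_mul_payoff (hΨ : E.PayoffAssumption) (hE : E.AgentAssumption)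
    {Y : Ω → StateSpace d} (hY : AEMeasurable Y P) {Z J : ℝ → ℝ} {C : ℝ}
    (hp : IsClearingProfile (E.αI + E.αN) C Z J) (κ : ℝ) :
    Integrable (fun ω => (Z (E.vartheta (Y ω) h + κ) * E.signalWeight (Y ω) h) • E.Ψ (Y ω)) P := by
  have hbY := isBudgetData_norm hΨ hE h hY
  refine (hbY.integrable_eZ hp κ).mono ?_ (Eventually.of_forall fun ω => ?_)
  · exact (hbY.aestronglyMeasurable_Z hp κ).smul
      (hΨ.contDiff.continuous.measurable.comp_aemeasurable hY).aestronglyMeasurable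
  · rw [norm_smul, norm_mul (‖_‖ + 1), mul_comm]
    gcongr
    rw [Real.norm_of_nonneg (by positivity)]
    linarith

theorem Setting.limit_price {T : ℝ≥0} {B : ℝ≥0 → Ω → StateSpace d}
    {b : StateSpace d → StateSpace d} {a : StateSpace d → Matrix (Fin d) (Fin d) ℝ}
    {x₀ : StateSpace d} {X : ℝ≥0 → Ω → StateSpace d} (hS : E.Setting P T B b a x₀ X)
    (h : StateSpace d) :
    (∀ η ∈ Set.Ioc (0 : ℝ) 1,
      (∀ (x : StateSpace d) (κ : ℝ), ∃! z : ℝ, E.SolvesClearing (crraUtility η) x h κ z) ∧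
      ∃! κ : ℝ, E.SolvesBudget P (X T) (crraUtility η) h κ) ∧
    (∃! κ : ℝ, E.SolvesLimit P (X T) h κ) ∧
    ∀ t ≤ T, ∀ (x : StateSpace d) (Y : ℝ≥0 → Ω → StateSpace d),
      IsStrongSolution P B b a T t x Y →
      (∀ η ∈ Set.Ioc (0 : ℝ) 1,
        IsProbabilityMeasure (E.pricingMeasure P (X T) (crraUtility η) h (Y T)) ∧
        Integrable (fun ω => E.Ψ (Y T ω))
          (E.pricingMeasure P (X T) (crraUtility η) h (Y T))) ∧
      Integrable (fun ω => E.limitWeight h (E.kappaHatZero P (X T) h) (Y T ω)) P ∧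
      Integrable (fun ω =>
        E.limitWeight h (E.kappaHatZero P (X T) h) (Y T ω) • E.Ψ (Y T ω)) P ∧
      Tendsto (fun η : ℝ => E.price P (X T) (crraUtility η) h (Y T)) (𝓝[>] 0)
        (𝓝 (E.limitPrice P (X T) h (Y T))) := by
  have hE := hS.agents
  have hΨ := hS.payoff
  have hc := hE.ωU_pos
  have hA := hE.tolerance_pos
  have hX := hS.solution.aemeasurable hS.brownian (s := T) ⟨zero_le, le_rfl⟩
  have hb := isBudgetData_endowU hΨ hE h hX hS.endowU_pos
  refine ⟨fun η hη => ⟨fun x κ => existsUnique_solvesClearing hE hη x h κ,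
    existsUnique_solvesBudget hE hb hη⟩, existsUnique_solvesLimit hE hb,
    fun t ht x Y hYsol => ?_⟩
  have hY := hYsol.aemeasurable hS.brownian (s := T) ⟨ht, le_rfl⟩
  have hbY := isBudgetData_norm hΨ hE h hY
  refine ⟨fun η hη => ?_, ?_, ?_, tendsto_price hΨ hE hb hY⟩
  · have hp := isClearingProfile_clearingLog hc hA hη
    have hpos : ∀ ω, 0 < Real.exp (clearingLog E.ωU (E.αI + E.αN) η
        (E.vartheta (Y T ω) h + E.kappaHat P (X T) (crraUtility η) h)) *
        E.signalWeight (Y T ω) h := fun ω => mul_pos (Real.exp_pos _) (E.signalWeight_pos _ _)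
    rw [pricingMeasure_eq hE hb hη]
    exact ⟨isProbabilityMeasure_withDensity_div (hbY.integrable_Z hp _) hpos,
      integrable_withDensity_div (hbY.integrable_Z hp _) hpos (integrable_mul_payoff hΨ hE hY hp _)⟩
  · simp only [limitWeight_eq]
    exact hbY.integrable_Z (isClearingProfile_limit hc hA) _
  · simp only [limitWeight_eq]
    exact integrable_mul_payoff hΨ hE hY (isClearingProfile_limit hc hA) _

end Economy

/-! ### Brownian motion as a factor process -/

theorem IsBrownianMotion.isStrongSolution {Ω : Type*} [MeasurableSpace Ω] {P : Measure Ω} {d : ℕ}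
    {W : ℝ≥0 → Ω → StateSpace d} (hW : IsBrownianMotion W P) (T : ℝ≥0) :
    IsStrongSolution P W (fun _ => 0) (fun _ => 1) T 0 0 W := by
  have h0 : ∀ᵐ ω ∂P, W 0 ω = 0 := by
    have := ae_all_iff.2 fun i => (hW.coord i).eval_zero_ae_eq_zero
    filter_upwards [this] with ω hω
    ext i
    simpa using hω i
  refine ⟨fun s _ => ⟨W s, ?_, ae_eq_rfl⟩, ?_, h0, fun s _ => ?_⟩
  · have hle : MeasurableSpace.comap (W s) inferInstance ≤ pastSigma W s :=
      le_iSup₂_of_le s (Set.mem_Iic.2 le_rfl) le_rfl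
    exact (comap_measurable (W s)).mono hle le_rfl
  · have := ae_all_iff.2 fun i => (hW.coord i).cont
    filter_upwards [this] with ω hω
    have h1 : Continuous fun s => WithLp.toLp 2 (fun i => W s ω i) :=
      (PiLp.continuous_toLp 2 _).comp (continuous_pi hω)
    exact h1.continuousOn
  -- With unit volatility the Riemann sums telescope, so the convergence in measure is eventually an
  -- almost sure equality.
  · have hsum : ∀ n : ℕ, 0 < n → ∀ ω, itoSum W (fun _ => 1) W 0 s n ω = W s ω - W 0 ω := by
      intro n hn ω
      have h1 := Finset.sum_range_sub (fun k : ℕ => W (0 + k * ((s - 0) / n)) ω) n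
      have hn' : (n : ℝ≥0) ≠ 0 := by positivity
      simp only [Nat.cast_add, Nat.cast_one, Nat.cast_zero, zero_mul, add_zero, zero_add,
        tsub_zero, mul_div_cancel₀ _ hn'] at h1
      simpa [itoSum] using h1
    refine TendstoInMeasure.congr' (f := fun _ => W s) (g := W s) ?_ ?_ ?_
    · filter_upwards [eventually_gt_atTop 0] with n hn
      filter_upwards [h0] with ω hω
      rw [hsum n hn, hω, sub_zero]
    · exact Eventually.of_forall fun ω => by simp
    · intro ε hε
      simp [hε.ne']

theorem coeffAssumption_const (d : ℕ) :
    CoeffAssumption (d := d) (fun _ => 0) (fun _ => 1) where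
  drift_bdd := ⟨0, by simp⟩
  drift_lip := ⟨0, by simp⟩
  vol_bdd := ⟨1, fun _ i j => by
    rw [Matrix.one_apply]
    split_ifs <;> simp⟩
  vol_lip := ⟨0, by simp⟩
  vol_invertible := by simp
  vol_inv_bdd := ⟨1, fun _ i j => by
    rw [inv_one, Matrix.one_apply]
    split_ifs <;> simp⟩

/-! ### A one-dimensional economy with exponential payoff -/

/-- An economy with payoff `exp x`, unit supply, mean shift `m` of the noise trader's signal and
initial endowment `ε` of the uninformed agent. -/
noncomputable def expEconomy (m ε : ℝ) : Economy 1 where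
  ωI := 1 / 4
  ωN := 1 / 4
  γI := 1 / 4
  γN := 1 / 4
  τN := 0
  μN := EuclideanSpace.single 0 m
  CI := 1
  CN := 1
  supply := EuclideanSpace.single 0 1
  endowI := EuclideanSpace.single 0 (4 - 2 * ε)
  endowN := 0
  endowU := EuclideanSpace.single 0 ε
  Ψ := fun x => Real.exp (x 0) • EuclideanSpace.single 0 1

namespace expEconomy

variable {m ε : ℝ}

theorem ωU_eq : (expEconomy m ε).ωU = 1 / 2 := by
  norm_num [Economy.ωU, expEconomy]

theorem αI_eq : (expEconomy m ε).αI = 1 := by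
  norm_num [Economy.αI, expEconomy]

theorem αN_eq : (expEconomy m ε).αN = 1 := by
  norm_num [Economy.αN, expEconomy]

theorem PI_eq : (expEconomy m ε).PI = 1 := by
  simp [Economy.PI, expEconomy]

theorem PU_eq : (expEconomy m ε).PU = (1 / 2 : ℝ) • 1 := by
  have h : (expEconomy m ε).CU = (2 : ℝ) • 1 := by
    rw [Economy.CU, αI_eq, αN_eq]
    simp [expEconomy, two_smul]
  rw [Economy.PU, h]
  refine Matrix.inv_eq_right_inv ?_
  simp [smul_smul]

theorem vartheta_eq (x : StateSpace 1) : (expEconomy m ε).vartheta x 0 =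
    Real.exp (x 0) + (x 0 - m) ^ 2 / 2 - m ^ 2 / 2 := by
  rw [Economy.vartheta, PI_eq, PU_eq, αI_eq, αN_eq]
  simp only [expEconomy, dotProduct, Matrix.mulVec, Finset.univ_unique, Fin.default_eq_zero,
    Finset.sum_singleton, Matrix.one_apply_eq, Matrix.sub_apply, Matrix.smul_apply,
    inner_smul_right, EuclideanSpace.inner_single_left, PiLp.single_apply, PiLp.zero_apply]
  simp
  ring

theorem signalWeight_eq (x : StateSpace 1) :
    (expEconomy m ε).signalWeight x 0 = Real.exp (-(x 0 ^ 2 / 4)) := by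
  rw [Economy.signalWeight, PU_eq]
  simp [dotProduct, Matrix.mulVec]
  ring

theorem inner_endowU_eq (x : StateSpace 1) :
    inner ℝ (expEconomy m ε).endowU ((expEconomy m ε).Ψ x) = ε * Real.exp (x 0) := by
  simp [expEconomy, inner_smul_right, EuclideanSpace.inner_single_left, mul_comm]

theorem agentAssumption : (expEconomy m ε).AgentAssumption where
  ωI_pos := by norm_num [expEconomy]
  ωN_pos := by norm_num [expEconomy]
  ωU_pos := by norm_num [ωU_eq]
  γI_pos := by norm_num [expEconomy]
  γN_pos := by norm_num [expEconomy]
  CI_posDef := Matrix.PosDef.one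
  CN_posDef := Matrix.PosDef.one
  signal := by
    rw [αI_eq, αN_eq]
    norm_num [expEconomy]
  clearing := by
    rw [ωU_eq]
    ext i
    fin_cases i
    simp [expEconomy]
    ring

theorem hasFDerivAt_payoff (x : StateSpace 1) :
    HasFDerivAt (expEconomy m ε).Ψ
      (Real.exp (x 0) • ContinuousLinearMap.id ℝ (StateSpace 1)) x := by
  have h1 : HasFDerivAt (fun y : StateSpace 1 => y 0) (EuclideanSpace.proj (𝕜 := ℝ) 0) x :=
    (EuclideanSpace.proj (𝕜 := ℝ) (0 : Fin 1)).hasFDerivAt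
  have h2 := h1.exp.smul_const (EuclideanSpace.single 0 1 : StateSpace 1)
  refine h2.congr_fderiv ?_
  ext y i
  fin_cases i
  simp

theorem payoffAssumption : (expEconomy m ε).PayoffAssumption where
  contDiff := by
    have h1 : ContDiff ℝ 1 fun y : StateSpace 1 => y 0 :=
      (EuclideanSpace.proj (𝕜 := ℝ) (0 : Fin 1)).contDiff
    exact h1.exp.smul contDiff_const
  supply_pos x := by
    simp [expEconomy, inner_smul_right, Real.exp_pos]
  jacobian := Eventually.of_forall fun x => by
    rw [(hasFDerivAt_payoff x).fderiv, ContinuousLinearMap.det, ContinuousLinearMap.toLinearMap_smul,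
      LinearMap.det_smul]
    simp
  growth := by
    refine ⟨1, one_pos, fun x => ?_⟩
    have h : Real.exp (x 0) ≤ Real.exp (1 * (1 + ‖x‖)) := by
      apply Real.exp_le_exp.2
      have := (le_abs_self _).trans (PiLp.norm_apply_le x 0)
      linarith
    refine ⟨?_, fun i => ?_⟩
    · simpa [expEconomy, norm_smul] using h
    · rw [(hasFDerivAt_payoff x).fderiv]
      simpa [norm_smul] using h

end expEconomy

/-- A nondegenerate Gaussian law charges every nonempty open set. -/
theorem integral_pos_of_hasLaw_gaussianReal {Ω : Type*} [MeasurableSpace Ω] {P : Measure Ω}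
    {V : Ω → ℝ} {μ : ℝ} {v : ℝ≥0} (hV : HasLaw V (gaussianReal μ v) P) (hv : v ≠ 0) {f : ℝ → ℝ}
    (hf : Continuous f) (hint : Integrable (fun ω => f (V ω)) P) (hnonneg : 0 ≤ f) {u : ℝ}
    (hu : f u ≠ 0) : 0 < ∫ ω, f (V ω) ∂P := by
  have : (gaussianReal μ v).IsOpenPosMeasure :=
    (gaussianReal_absolutelyContinuous' μ hv).isOpenPosMeasure
  have hm : AEStronglyMeasurable f (P.map V) := hf.aestronglyMeasurable
  have h1 : Integrable f (gaussianReal μ v) := by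
    rw [← hV.map_eq, integrable_map_measure hm hV.aemeasurable]
    exact hint
  rw [← integral_map hV.aemeasurable hm, hV.map_eq]
  exact integral_pos_of_integrable_nonneg_nonzero hf h1 hnonneg hu

namespace expEconomy

variable {Ω : Type*} [MeasurableSpace Ω] {P : Measure Ω} [IsProbabilityMeasure P] {m ε : ℝ}

theorem isBudgetData (hε : 0 < ε) {Y : Ω → StateSpace 1} (hY : AEMeasurable Y P) :
    IsBudgetData P ((expEconomy m ε).αI + (expEconomy m ε).αN)
      (fun ω => (expEconomy m ε).vartheta (Y ω) 0)
      (fun ω => (expEconomy m ε).signalWeight (Y ω) 0)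
      (fun ω => inner ℝ (expEconomy m ε).endowU ((expEconomy m ε).Ψ (Y ω))) := by
  refine Economy.isBudgetData_endowU payoffAssumption agentAssumption 0 hY
    (Eventually.of_forall fun ω => ?_)
  rw [inner_endowU_eq]
  positivity

/-- The endowment of the uninformed agent can be chosen to realize a prescribed constant in the
limiting budget equation. -/
theorem exists_solvesLimit {Y : Ω → StateSpace 1} {v : ℝ≥0} (hv : v ≠ 0)
    (hY : HasLaw (fun ω => Y ω 0) (gaussianReal 0 v) P) (hYm : AEMeasurable Y P) (m κ : ℝ) :
    ∃ ε > 0, (expEconomy m ε).SolvesLimit P Y 0 κ := by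
  -- For fixed `κ` the limiting gap is `ε N - D`, where `N` is the value of a unit endowment and `D`
  -- that of consumption; hence `ε = D / N`.
  have hb := isBudgetData (P := P) (m := m) one_pos hYm
  have hp := isClearingProfile_limit (c := 1 / 2) (A := 2) (by norm_num) (by norm_num)
  simp only [αI_eq, αN_eq, inner_endowU_eq, vartheta_eq, signalWeight_eq, one_mul,
    one_add_one_eq_two] at hb
  have hN := hb.integral_eZ_pos hp κ
  have hD : 0 < ∫ ω, max (Real.exp (Y ω 0) + (Y ω 0 - m) ^ 2 / 2 - m ^ 2 / 2 + κ) 0 / (1 / 2) *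
      Real.exp (-(Y ω 0 ^ 2 / 4)) ∂P := by
    -- At `u = m + s` with `s = m² + 2|κ| + 1 ≥ 1`, the term `s²/2 ≥ s/2` already exceeds `m²/2 -
    -- κ`.
    refine integral_pos_of_hasLaw_gaussianReal hY hv
      (f := fun u => max (Real.exp u + (u - m) ^ 2 / 2 - m ^ 2 / 2 + κ) 0 / (1 / 2) *
        Real.exp (-(u ^ 2 / 4))) (by fun_prop) (hb.integrable_J hp κ)
      (fun u => by simp only [Pi.zero_apply]; positivity) (u := m + (m ^ 2 + 2 * |κ| + 1)) ?_
    have h1 : 0 < Real.exp (m + (m ^ 2 + 2 * |κ| + 1)) +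
        (m + (m ^ 2 + 2 * |κ| + 1) - m) ^ 2 / 2 - m ^ 2 / 2 + κ := by
      have := Real.exp_pos (m + (m ^ 2 + 2 * |κ| + 1))
      have := neg_abs_le κ
      have := abs_nonneg κ
      nlinarith [sq_nonneg m]
    simp only
    rw [max_eq_left h1.le]
    positivity
  set N := ∫ ω, Real.exp (Y ω 0) * (Real.exp (max (-(Real.exp (Y ω 0) + (Y ω 0 - m) ^ 2 / 2 -
    m ^ 2 / 2 + κ)) 0 / 2) * Real.exp (-(Y ω 0 ^ 2 / 4))) ∂P with hNdef
  set D := ∫ ω, max (Real.exp (Y ω 0) + (Y ω 0 - m) ^ 2 / 2 - m ^ 2 / 2 + κ) 0 / (1 / 2) *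
    Real.exp (-(Y ω 0 ^ 2 / 4)) ∂P with hDdef
  have hε : 0 < D / N := div_pos hD hN
  refine ⟨D / N, hε, ?_⟩
  rw [Economy.solvesLimit_iff agentAssumption (isBudgetData hε hYm)]
  simp only [budgetGap, αI_eq, αN_eq, ωU_eq, inner_endowU_eq, vartheta_eq, signalWeight_eq,
    one_add_one_eq_two, mul_assoc, integral_const_mul]
  rw [← hNdef, ← hDdef, div_mul_cancel₀ _ hN.ne', sub_self]

omit [IsProbabilityMeasure P] in
theorem riskNeutralPrice_eq (Y : Ω → StateSpace 1) :
    (expEconomy m ε).riskNeutralPrice P 0 Y =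
      ((∫ ω, Real.exp (-(Y ω 0 ^ 2 / 4)) ∂P)⁻¹ *
        ∫ ω, Real.exp (-(Y ω 0 ^ 2 / 4)) * Real.exp (Y ω 0) ∂P) • EuclideanSpace.single 0 1 := by
  simp only [Economy.riskNeutralPrice, signalWeight_eq]
  simp only [expEconomy, smul_smul, integral_smul_const]

omit [IsProbabilityMeasure P] in
theorem limitPrice_eq (Y : Ω → StateSpace 1) :
    (expEconomy m ε).limitPrice P Y 0 Y =
      ((∫ ω, (expEconomy m ε).limitWeight 0 ((expEconomy m ε).kappaHatZero P Y 0) (Y ω) ∂P)⁻¹ *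
        ∫ ω, (expEconomy m ε).limitWeight 0 ((expEconomy m ε).kappaHatZero P Y 0) (Y ω) *
          Real.exp (Y ω 0) ∂P) • EuclideanSpace.single 0 1 := by
  have h (x : StateSpace 1) :
      (expEconomy m ε).Ψ x = Real.exp (x 0) • EuclideanSpace.single 0 1 := rfl
  simp only [Economy.limitPrice, h, smul_smul, integral_smul_const]

theorem exists_limitPrice_ne_riskNeutralPrice {Y : Ω → StateSpace 1} {v : ℝ≥0} (hv : v ≠ 0)
    (hY : HasLaw (fun ω => Y ω 0) (gaussianReal 0 v) P) (hYm : AEMeasurable Y P) :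
    ∃ m ε, 0 < ε ∧
      (expEconomy m ε).limitPrice P Y 0 Y ≠ (expEconomy m ε).riskNeutralPrice P 0 Y := by
  have hVm := hY.aemeasurable
  have hw : Integrable (fun ω => Real.exp (-(Y ω 0 ^ 2 / 4))) P := by
    refine Integrable.of_bound (C := 1) (AEMeasurable.aestronglyMeasurable (by fun_prop))
      (Eventually.of_forall fun ω => ?_)
    rw [Real.norm_of_nonneg (Real.exp_pos _).le]
    exact Real.exp_le_one_iff.2 (by nlinarith [sq_nonneg (Y ω 0)])
  have hwe : Integrable (fun ω => Real.exp (-(Y ω 0 ^ 2 / 4)) * Real.exp (Y ω 0)) P := by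
    refine Integrable.of_bound (C := Real.exp 1) (AEMeasurable.aestronglyMeasurable (by fun_prop))
      (Eventually.of_forall fun ω => ?_)
    rw [Real.norm_of_nonneg (by positivity), ← Real.exp_add]
    exact Real.exp_le_exp.2 (by nlinarith [sq_nonneg (Y ω 0 - 2)])
  have hw0 := integral_pos_of_ae_pos hw (Eventually.of_forall fun ω => Real.exp_pos _)
  have hwe0 := integral_pos_of_ae_pos hwe
    (Eventually.of_forall fun ω => mul_pos (Real.exp_pos _) (Real.exp_pos _))
  set c := (∫ ω, Real.exp (-(Y ω 0 ^ 2 / 4)) ∂P)⁻¹ *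
    ∫ ω, Real.exp (-(Y ω 0 ^ 2 / 4)) * Real.exp (Y ω 0) ∂P with hc
  have hc0 : 0 < c := by positivity
  -- With this `κ`, `ϑ + κ = e^x + (x - m)²/2 - 1/2`, which is negative only if `|x - m| < 1`. As `m
  -- + 1 ≤ log c`, the payoff there is at most the risk-neutral price `c`; as `m ≤ -1`, the value at
  -- `x = m` is indeed negative.
  set m := min (Real.log c) 0 - 1 with hm
  set κ := m ^ 2 / 2 - 1 / 2 with hκ
  have hm1 : m + 1 ≤ Real.log c := by
    rw [hm]
    linarith [min_le_left (Real.log c) 0]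
  have hm2 : m ≤ -1 := by
    rw [hm]
    linarith [min_le_right (Real.log c) 0]
  obtain ⟨ε, hε, hsol⟩ := exists_solvesLimit hv hY hYm m κ
  refine ⟨m, ε, hε, ?_⟩
  have hb := isBudgetData (P := P) (m := m) hε hYm
  have hkappa : (expEconomy m ε).kappaHatZero P Y 0 = κ :=
    (Economy.existsUnique_solvesLimit agentAssumption hb).unique
      (Classical.epsilon_spec ⟨κ, hsol⟩) hsol
  rw [limitPrice_eq, riskNeutralPrice_eq, hkappa, ← hc]
  intro heq
  have hne : (EuclideanSpace.single 0 1 : StateSpace 1) ≠ 0 := by simp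
  have heq := smul_left_injective ℝ hne heq
  have hp := isClearingProfile_limit (c := 1 / 2) (A := 2) (by norm_num) (by norm_num)
  simp only [Economy.limitWeight_eq, vartheta_eq, signalWeight_eq, αI_eq, αN_eq,
    one_add_one_eq_two, inner_endowU_eq] at heq hb
  have hb1 := isBudgetData (P := P) (m := m) one_pos hYm
  simp only [αI_eq, αN_eq, inner_endowU_eq, vartheta_eq, signalWeight_eq, one_mul,
    one_add_one_eq_two] at hb1
  have hL := hb1.integrable_Z hp κ
  have hLe := hb1.integrable_eZ hp κ
  have hL0 := hb1.integral_Z_pos hp κ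
  simp only [mul_comm (Real.exp (Y _ 0))] at hLe
  -- The first factor is nonnegative wherever the second is nonzero, and both are positive at `m`.
  -- If both prices equalled `c`, expanding the product would give zero.
  have hpos : 0 < ∫ ω, (c - Real.exp (Y ω 0)) *
      (Real.exp (max (-(Real.exp (Y ω 0) + (Y ω 0 - m) ^ 2 / 2 - m ^ 2 / 2 + κ)) 0 / 2) - 1) *
      Real.exp (-(Y ω 0 ^ 2 / 4)) ∂P := by
    refine integral_pos_of_hasLaw_gaussianReal hY hv
      (f := fun u => (c - Real.exp u) *
        (Real.exp (max (-(Real.exp u + (u - m) ^ 2 / 2 - m ^ 2 / 2 + κ)) 0 / 2) - 1) *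
        Real.exp (-(u ^ 2 / 4))) (by fun_prop) ?_ (fun u => ?_) (u := m) ?_
    · refine ((((hL.const_mul c).sub hLe).sub (hw.const_mul c)).add hwe).congr
        (Eventually.of_forall fun ω => ?_)
      simp only [Pi.add_apply, Pi.sub_apply]
      ring
    · simp only [Pi.zero_apply]
      rcases le_or_gt 0 (Real.exp u + (u - m) ^ 2 / 2 - m ^ 2 / 2 + κ) with h | h
      · rw [max_eq_right (by linarith)]
        simp
      · have h1 : Real.exp u ≤ c := by
          rw [← Real.exp_log hc0]
          apply Real.exp_le_exp.2
          have := Real.exp_pos u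
          nlinarith
        have h2 : 1 ≤ Real.exp
            (max (-(Real.exp u + (u - m) ^ 2 / 2 - m ^ 2 / 2 + κ)) 0 / 2) :=
          Real.one_le_exp (by positivity)
        have := sub_nonneg.2 h1
        have := sub_nonneg.2 h2
        positivity
    · have h1 : Real.exp m < c := by
        rw [← Real.exp_log hc0]
        exact Real.exp_lt_exp.2 (by linarith)
      have h2 : Real.exp m < 1 / 2 := by
        have h3 : Real.exp m ≤ Real.exp (-1) := Real.exp_le_exp.2 hm2
        have h4 := Real.exp_neg_one_lt_d9
        linarith
      have h3 : 1 < Real.exp (max (-(Real.exp m + (m - m) ^ 2 / 2 - m ^ 2 / 2 + κ)) 0 / 2) := by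
        rw [Real.one_lt_exp_iff]
        refine div_pos (lt_max_of_lt_left ?_) two_pos
        rw [hκ, sub_self]
        linarith
      exact mul_ne_zero (mul_ne_zero (sub_pos.2 h1).ne' (sub_pos.2 h3).ne') (Real.exp_pos _).ne'
  have hsplit : ∫ ω, (c - Real.exp (Y ω 0)) *
      (Real.exp (max (-(Real.exp (Y ω 0) + (Y ω 0 - m) ^ 2 / 2 - m ^ 2 / 2 + κ)) 0 / 2) - 1) *
      Real.exp (-(Y ω 0 ^ 2 / 4)) ∂P =
      (c * ∫ ω, Real.exp (max (-(Real.exp (Y ω 0) + (Y ω 0 - m) ^ 2 / 2 - m ^ 2 / 2 + κ)) 0 / 2) *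
        Real.exp (-(Y ω 0 ^ 2 / 4)) ∂P -
      ∫ ω, Real.exp (max (-(Real.exp (Y ω 0) + (Y ω 0 - m) ^ 2 / 2 - m ^ 2 / 2 + κ)) 0 / 2) *
        Real.exp (-(Y ω 0 ^ 2 / 4)) * Real.exp (Y ω 0) ∂P) -
      (c * ∫ ω, Real.exp (-(Y ω 0 ^ 2 / 4)) ∂P -
        ∫ ω, Real.exp (-(Y ω 0 ^ 2 / 4)) * Real.exp (Y ω 0) ∂P) := by
    rw [← integral_const_mul, ← integral_const_mul, ← integral_sub (hL.const_mul c) hLe,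
      ← integral_sub (hw.const_mul c) hwe]
    refine (integral_congr_ae (Eventually.of_forall fun ω => ?_)).trans
      (integral_sub ((hL.const_mul c).sub hLe) ((hw.const_mul c).sub hwe))
    simp only
    ring
  have e1 := (inv_mul_eq_iff_eq_mul₀ hL0.ne').1 heq
  have e2 := (inv_mul_eq_iff_eq_mul₀ hw0.ne').1 hc.symm
  rw [hsplit, e1, e2] at hpos
  linarith

end expEconomy

theorem proposition8p2 {Ω : Type*} [MeasurableSpace Ω] (P : Measure Ω) [IsProbabilityMeasure P]
    (T : ℝ≥0) (hT : 0 < T) :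
    -- convergence of the pricing function as the relative risk aversion vanishes
    (∀ (d : ℕ) (E : Economy d) (B : ℝ≥0 → Ω → StateSpace d)
        (b : StateSpace d → StateSpace d) (a : StateSpace d → Matrix (Fin d) (Fin d) ℝ)
        (x₀ : StateSpace d) (X : ℝ≥0 → Ω → StateSpace d),
      E.Setting P T B b a x₀ X →
      ∀ h : StateSpace d,
        -- the objects entering the pricing functions are well defined
        (∀ η ∈ Set.Ioc (0 : ℝ) 1,
          (∀ (x : StateSpace d) (κ : ℝ), ∃! z : ℝ, E.SolvesClearing (crraUtility η) x h κ z) ∧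
          ∃! κ : ℝ, E.SolvesBudget P (X T) (crraUtility η) h κ) ∧
        (∃! κ : ℝ, E.SolvesLimit P (X T) h κ) ∧
        -- for all `(t, x)`, with `Y` the diffusion started from `x` at time `t`
        ∀ t ≤ T, ∀ (x : StateSpace d) (Y : ℝ≥0 → Ω → StateSpace d),
          IsStrongSolution P B b a T t x Y →
          (∀ η ∈ Set.Ioc (0 : ℝ) 1,
            IsProbabilityMeasure (E.pricingMeasure P (X T) (crraUtility η) h (Y T)) ∧
            Integrable (fun ω => E.Ψ (Y T ω))
              (E.pricingMeasure P (X T) (crraUtility η) h (Y T))) ∧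
          Integrable (fun ω => E.limitWeight h (E.kappaHatZero P (X T) h) (Y T ω)) P ∧
          Integrable (fun ω =>
            E.limitWeight h (E.kappaHatZero P (X T) h) (Y T ω) • E.Ψ (Y T ω)) P ∧
          Tendsto (fun η : ℝ => E.price P (X T) (crraUtility η) h (Y T)) (𝓝[>] 0)
            (𝓝 (E.limitPrice P (X T) h (Y T)))) ∧
    -- the limit is in general not the risk neutral price, even for Gaussian factors
    (∀ W : ℝ≥0 → Ω → StateSpace 1, IsBrownianMotion W P →
      ∃ (E : Economy 1) (b : StateSpace 1 → StateSpace 1)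
        (a : StateSpace 1 → Matrix (Fin 1) (Fin 1) ℝ) (x₀ : StateSpace 1)
        (X : ℝ≥0 → Ω → StateSpace 1) (h : StateSpace 1),
        E.Setting P T W b a x₀ X ∧ HasGaussianLaw (X T) P ∧
        E.limitPrice P (X T) h (X T) ≠ E.riskNeutralPrice P h (X T)) := by

  refine ⟨fun d E B b a x₀ X hS h => hS.limit_price h, fun W hW => ?_⟩
  have hlaw := (hW.coord 0).hasLaw_eval T
  obtain ⟨m, ε, hε, hne⟩ := expEconomy.exists_limitPrice_ne_riskNeutralPrice hT.ne' hlaw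
    (hW.measurable T).aemeasurable
  refine ⟨expEconomy m ε, fun _ => 0, fun _ => 1, 0, W, 0,
    ⟨hW, coeffAssumption_const 1, hW.isStrongSolution T, expEconomy.payoffAssumption,
      expEconomy.agentAssumption, Eventually.of_forall fun ω => ?_⟩, ?_, hne⟩
  · rw [expEconomy.inner_endowU_eq]
    positivity
  -- In dimension one `W T` is the image of its coordinate under a linear embedding.
  · have h := hlaw.hasGaussianLaw.map_fun
      ((ContinuousLinearMap.id ℝ ℝ).smulRight (EuclideanSpace.single 0 1 : StateSpace 1))
    refine h.congr (Eventually.of_forall fun ω => ?_)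
    ext i
    fin_cases i
    simp
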